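/- Let $$\rho^{(3)}(q)=\sum_{n=0}^{\infty}\frac{q^{2n(n+1)}\,(q;q^2)_{n+1}}{(q^3;q^6)_{n+1}},\qquad (a;q)_n=\prod_{k=0}^{n-1}(1-aq^k),$$ be Ramanujan's third order mock theta function, viewed as a formal power series in $q$ with integer coefficients, and let $c(\rho^{(3)};n)$ denote the coefficient of $q^n$ in it, so that $\rho^{(3)}(q)=\sum_{n\ge 0}c(\rho^{(3)};n)q^n$. Then $c(\rho^{(3)};n)$ is even for almost all $n$, that is, $$\lim_{N\to\infty}\frac{\#\{0\le n<N:\ c(\rho^{(3)};n)\equiv 0 \pmod 2\}}{N}=1.$$ -/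

import Mathlib

open Filter Topology PowerSeries
open scoped PowerSeries.WithPiTopology

/-- The `q`-Pochhammer symbol `(a; q)_n = ∏_{k=0}^{n-1} (1 - a q^k)`. -/
def qPoch {R : Type*} [CommRing R] (a q : R) (n : ℕ) : R :=
  ∏ k ∈ Finset.range n, (1 - a * q ^ k)

/-- The `n`-th summand `q^{2n(n+1)} (q; q^2)_{n+1} / (q^3; q^6)_{n+1}` of `ρ^{(3)}(q)`, a formal
power series in `q` (written `X`) with integer coefficients. The denominator has constant
coefficient `1`, so it is a unit of `ℤ⟦X⟧`, and `invOfUnit _ 1` is its inverse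
(see `qPoch_mul_invOfUnit`). -/
noncomputable def rhoThreeTerm (n : ℕ) : ℤ⟦X⟧ :=
  X ^ (2 * n * (n + 1)) * qPoch (X : ℤ⟦X⟧) (X ^ 2) (n + 1) *
    invOfUnit (qPoch ((X : ℤ⟦X⟧) ^ 3) (X ^ 6) (n + 1)) 1

theorem qPoch_mul_invOfUnit (n : ℕ) :
    qPoch ((X : ℤ⟦X⟧) ^ 3) (X ^ 6) n * invOfUnit (qPoch ((X : ℤ⟦X⟧) ^ 3) (X ^ 6) n) 1 = 1 := by
  apply mul_invOfUnit
  simp [qPoch, map_prod]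

theorem coeff_rhoThreeTerm_eq_zero {m n : ℕ} (h : m < 2 * n * (n + 1)) :
    coeff m (rhoThreeTerm n) = 0 := by
  rw [rhoThreeTerm, mul_assoc, coeff_X_pow_mul']
  exact if_neg (by omega)

/-- Ramanujan's third order mock theta function
`ρ^{(3)}(q) = ∑_{n ≥ 0} q^{2n(n+1)} (q; q^2)_{n+1} / (q^3; q^6)_{n+1}`, as a formal power series;
the infinite sum is taken in the topology of coefficientwise convergence on `ℤ⟦X⟧`, `ℤ` discrete
(it converges, see `hasSum_rhoThree`). -/
noncomputable def rhoThree : ℤ⟦X⟧ := ∑' n : ℕ, rhoThreeTerm n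

theorem hasSum_rhoThree : HasSum rhoThreeTerm rhoThree := by
  have h : HasSum rhoThreeTerm
      (PowerSeries.mk fun m => ∑ n ∈ Finset.range (m + 1), coeff m (rhoThreeTerm n)) := by
    rw [WithPiTopology.hasSum_iff_hasSum_coeff]
    intro m
    rw [coeff_mk]
    apply hasSum_sum_of_ne_finset_zero
    intro n hn
    apply coeff_rhoThreeTerm_eq_zero
    simp only [Finset.mem_range, not_lt] at hn
    nlinarith
  exact h.summable.hasSum

theorem coeff_rhoThree (m : ℕ) :
    coeff m rhoThree = ∑ n ∈ Finset.range (m + 1), coeff m (rhoThreeTerm n) := by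
  have h := ((WithPiTopology.hasSum_iff_hasSum_coeff ℤ).mp hasSum_rhoThree) m
  refine h.unique (hasSum_sum_of_ne_finset_zero ?_)
  intro n hn
  apply coeff_rhoThreeTerm_eq_zero
  simp only [Finset.mem_range, not_lt] at hn
  nlinarith

/-! Modulo 2 the coefficient `c(n)` is the number of divisors `d ≡ 1 (mod 3)` of `M = 3n + 2`, which
is half the number of divisors of `M`, since `d ↦ M / d` swaps the residues 1 and 2. If this half is
odd then `4 ∤ d(M)`; as `M` is not a square, exactly one prime has odd exponent and `M = p k²`. By
Chebyshev's bound such numbers have density zero: `∑_k π(3N / k²) = o(N)`.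

The congruence is obtained by comparing two products with `P = ∑ q^i` over `12 i + 1` a square,
which is `(q²; q²)_∞` modulo 2.

For `P ρ`: with `Q = q²`, Bailey's lemma is applied to the unit pair, giving Euler's pentagonal
series, and to the pair with `β_n = ∏_{k ≤ n} (1 + q^(2k+1) + q^(4k+2))⁻¹`
(`prod_cyclotomic_bailey_pair`). Hence `(Q; Q)_∞ ρ = ∑ (-1)^r q^(3r(r+1)) (1 - q^(4r+2)) / (1 +
q^(2r+1) + q^(4r+2))`. Modulo 2 its coefficients count divisors `t ≤ √D` of `D = 12N + 9` with `3 ∣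
t` and cofactor prime to 3, plus a correction when `D` is a square
(`pentagonalIndicator_mul_rhoThree`).

For `P` times the half-divisor series: the coefficient counts solutions of `s² + 4de = D` in fixed
residue classes modulo 3. A windmill-type bijection turns them into quadratic polynomials of
discriminant `D` with a marked sign change, and reflecting these polynomials leaves, modulo 2, the
same divisor count (`pentagonalIndicator_mul_halfDivisorSeries`). Cancelling `P` gives
`map_rhoThree`. -/

theorem two_mul_choose_two_add (k : ℕ) : 2 * k.choose 2 + k = k * k := by
  induction k with
  | zero => rfl
  | succ k ih =>
    have : (k + 1).choose 2 = k.choose 2 + k := by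
      rw [Nat.choose_succ_succ' k 1, Nat.choose_one_right, add_comm]
    rw [this]; linarith

/-! ### Finite q-series identities: Bailey pairs and the terminating Bailey lemma -/

section FiniteIdentities

variable {K : Type*} [Field K] {Q : K}

theorem qPoch_succ {R : Type*} [CommRing R] (a q : R) (n : ℕ) :
    qPoch a q (n + 1) = qPoch a q n * (1 - a * q ^ n) :=
  Finset.prod_range_succ _ _

theorem qPoch_self_succ {R : Type*} [CommRing R] (q : R) (n : ℕ) :
    qPoch q q (n + 1) = qPoch q q n * (1 - q ^ (n + 1)) := by
  rw [qPoch_succ, pow_succ']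

theorem qPoch_self_ne_zero (hQ : ∀ n : ℕ, 1 - Q ^ (n + 1) ≠ 0) (n : ℕ) : qPoch Q Q n ≠ 0 := by
  refine Finset.prod_ne_zero_iff.mpr fun k _ => ?_
  rw [← pow_succ']; exact hQ k

/-- The homogeneous `q`-binomial theorem, divided by `(Q; Q)_m`. -/
theorem sum_antidiagonal_qBinomial (hQ : ∀ n : ℕ, 1 - Q ^ (n + 1) ≠ 0) (a b : K) (m : ℕ) :
    ∑ p ∈ Finset.HasAntidiagonal.antidiagonal m, (-1) ^ p.1 * Q ^ p.1.choose 2 * b ^ p.1 / qPoch Q Q p.1 *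
      (a ^ p.2 / qPoch Q Q p.2) = (∏ i ∈ Finset.range m, (a - b * Q ^ i)) / qPoch Q Q m := by
  induction m with
  | zero => simp [qPoch]
  | succ m ih =>
    have h0 := qPoch_self_ne_zero hQ
    rw [Finset.prod_range_succ, qPoch_self_succ, eq_div_iff (mul_ne_zero (h0 m) (hQ m))]
    rw [eq_div_iff (h0 m)] at ih
    have key : (∑ p ∈ Finset.HasAntidiagonal.antidiagonal (m + 1),
        (-1) ^ p.1 * Q ^ p.1.choose 2 * b ^ p.1 / qPoch Q Q p.1 * (a ^ p.2 / qPoch Q Q p.2)) *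
          (1 - Q ^ (m + 1)) = (∑ p ∈ Finset.HasAntidiagonal.antidiagonal m,
        (-1) ^ p.1 * Q ^ p.1.choose 2 * b ^ p.1 / qPoch Q Q p.1 * (a ^ p.2 / qPoch Q Q p.2)) *
          (a - b * Q ^ m) := by
      -- The q-Pascal splitting `1 - Q^(i+j) = (1 - Q^j) + Q^j (1 - Q^i)`: each part cancels the
      -- last factor of one denominator and kills one end of the sum.
      have split : ∀ p ∈ Finset.HasAntidiagonal.antidiagonal (m + 1),
          (-1) ^ p.1 * Q ^ p.1.choose 2 * b ^ p.1 / qPoch Q Q p.1 * (a ^ p.2 / qPoch Q Q p.2) *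
            (1 - Q ^ (m + 1)) =
          (-1) ^ p.1 * Q ^ p.1.choose 2 * b ^ p.1 / qPoch Q Q p.1 *
            (a ^ p.2 / qPoch Q Q p.2 * (1 - Q ^ p.2)) +
          (-1) ^ p.1 * Q ^ p.1.choose 2 * b ^ p.1 / qPoch Q Q p.1 * (1 - Q ^ p.1) *
            (Q ^ p.2 * (a ^ p.2 / qPoch Q Q p.2)) := by
        intro p hp
        rw [← Finset.HasAntidiagonal.mem_antidiagonal.mp hp, pow_add]; ring
      rw [Finset.sum_mul, Finset.sum_congr rfl split, Finset.sum_add_distrib,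
        Finset.Nat.sum_antidiagonal_succ', Finset.Nat.sum_antidiagonal_succ (n := m), mul_sub _ a,
        Finset.sum_mul, Finset.sum_mul]
      simp only [pow_zero, sub_self, mul_zero, zero_mul, zero_add]
      rw [sub_eq_add_neg, ← Finset.sum_neg_distrib]
      congr 1
      · refine Finset.sum_congr rfl fun p _ => ?_
        rw [qPoch_self_succ]
        have h1 := h0 p.1
        have h2 := h0 p.2
        have h3 := hQ p.2
        field_simp
        ring
      · refine Finset.sum_congr rfl fun p hp => ?_
        rw [qPoch_self_succ, Nat.choose_succ_succ' p.1 1, Nat.choose_one_right,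
          ← Finset.HasAntidiagonal.mem_antidiagonal.mp hp]
        have h1 := h0 p.1
        have h2 := h0 p.2
        have h3 := hQ p.1
        field_simp
        ring
    rw [mul_comm (qPoch Q Q m), ← mul_assoc, key, mul_right_comm, ih]

/-- The unit Bailey pair relative to `a = Q`. -/
theorem sum_unit_bailey_pair (hQ0 : Q ≠ 0) (hQ : ∀ n : ℕ, 1 - Q ^ (n + 1) ≠ 0) (n : ℕ) :
    ∑ r ∈ Finset.range (n + 1), (-1) ^ r * Q ^ r.choose 2 * (1 - Q ^ (2 * r + 1)) /
      (qPoch Q Q (n - r) * qPoch Q Q (n + r + 1)) = if n = 0 then 1 else 0 := by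
  have h0 := qPoch_self_ne_zero hQ
  split_ifs with hn
  · subst hn
    have := hQ 0
    simp only [zero_add, pow_one] at this
    simp [qPoch, this]
  -- The q-binomial product with `a = Q^(n+1)`, `b = 1` has a zero factor at `i = n + 1`, which is
  -- in range because `n ≥ 1`.
  have hz : ∏ i ∈ Finset.range (2 * n + 1), (Q ^ (n + 1) - 1 * Q ^ i) = 0 :=
    Finset.prod_eq_zero (i := n + 1) (Finset.mem_range.mpr (by omega)) (by simp)
  have h := sum_antidiagonal_qBinomial hQ (Q ^ (n + 1)) 1 (2 * n + 1)
  -- Halving the `2n + 2` terms and reversing the first half pairs the indices `n - r` and `n + 1 +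
  -- r`. They share a denominator, and together give the `r`-th term up to a factor independent of
  -- `r`.
  rw [hz, zero_div, Finset.Nat.sum_antidiagonal_eq_sum_range_succ_mk,
    show (2 * n + 1).succ = (n + 1) + (n + 1) by omega, Finset.sum_range_add,
    ← Finset.sum_range_reflect, ← Finset.sum_add_distrib] at h
  have hne : (-1 : K) ^ (n + 1) * Q ^ (3 * n.choose 2 + 3 * n) ≠ 0 :=
    mul_ne_zero (pow_ne_zero _ (by simp)) (pow_ne_zero _ hQ0)
  refine (mul_eq_zero.mp (Eq.trans ?_ h)).resolve_left hne
  rw [Finset.mul_sum]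
  refine Finset.sum_congr rfl fun r hr => ?_
  obtain ⟨s, rfl⟩ := Nat.exists_eq_add_of_le (Nat.lt_succ_iff.mp (Finset.mem_range.mp hr))
  have e1 : r + s + 1 - 1 - r = s := by omega
  have e2 : 2 * (r + s) + 1 - s = r + s + r + 1 := by omega
  have e3 : 2 * (r + s) + 1 - (r + s + r + 1) = s := by omega
  have e4 : r + s - r = s := by omega
  have e5 : r + s + 1 + r = r + s + r + 1 := by omega
  simp only [e1, e2, e3, e4, e5, one_pow, mul_one]
  have t1 := two_mul_choose_two_add s
  have t2 := two_mul_choose_two_add (r + s + r + 1)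
  have t3 := two_mul_choose_two_add r
  have t4 := two_mul_choose_two_add (r + s)
  have x1 : s.choose 2 + (r + s + 1) * (r + s + r + 1) =
      3 * (r + s).choose 2 + 3 * (r + s) + r.choose 2 + (2 * r + 1) := by
    nlinarith
  have x2 : (r + s + r + 1).choose 2 + (r + s + 1) * s =
      3 * (r + s).choose 2 + 3 * (r + s) + r.choose 2 := by
    nlinarith
  have y1 : Q ^ s.choose 2 * (Q ^ (r + s + 1)) ^ (r + s + r + 1) =
      Q ^ (3 * (r + s).choose 2 + 3 * (r + s)) * Q ^ r.choose 2 * Q ^ (2 * r + 1) := by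
    rw [← pow_mul, ← pow_add, x1, pow_add, pow_add]
  have y2 : Q ^ (r + s + r + 1).choose 2 * (Q ^ (r + s + 1)) ^ s =
      Q ^ (3 * (r + s).choose 2 + 3 * (r + s)) * Q ^ r.choose 2 := by
    rw [← pow_mul, ← pow_add, x2, pow_add]
  have s1 : (-1 : K) ^ (r + s + r + 1) = - (-1) ^ s := by
    rw [show r + s + r + 1 = 2 * r + s + 1 by ring, pow_succ, pow_add, pow_mul]; simp
  have s2 : (-1 : K) ^ (r + s + 1) * (-1) ^ r = - (-1) ^ s := by
    rw [← pow_add, show r + s + 1 + r = 2 * r + s + 1 by ring, pow_succ, pow_add, pow_mul]; simp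
  have g1 := h0 s
  have g2 := h0 (r + s + r + 1)
  rw [s1]
  rw [div_mul_div_comm, div_mul_div_comm, mul_comm (qPoch Q Q (r + s + r + 1)), ← add_div,
    mul_div_assoc']
  congr 1
  linear_combination (Q ^ (3 * (r + s).choose 2 + 3 * (r + s)) * Q ^ r.choose 2 *
    (1 - Q ^ (2 * r + 1))) * s2 - (-1) ^ s * y1 + (-1) ^ s * y2

/-- A terminating form of Cauchy's identity (the Durfee rectangle identity). -/
theorem sum_durfee_rectangle (hQ : ∀ n : ℕ, 1 - Q ^ (n + 1) ≠ 0) (N a : ℕ) :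
    ∑ p ∈ Finset.HasAntidiagonal.antidiagonal N, Q ^ (p.1 * (p.1 + a)) /
      (qPoch Q Q p.2 * qPoch Q Q p.1 * qPoch Q Q (p.1 + a)) =
      1 / (qPoch Q Q N * qPoch Q Q (N + a)) := by
  have h0 := qPoch_self_ne_zero hQ
  induction N generalizing a with
  | zero => simp [qPoch]
  | succ N ih =>
    have key : (∑ p ∈ Finset.HasAntidiagonal.antidiagonal (N + 1), Q ^ (p.1 * (p.1 + a)) /
        (qPoch Q Q p.2 * qPoch Q Q p.1 * qPoch Q Q (p.1 + a))) * (1 - Q ^ (N + 1)) =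
        1 / (qPoch Q Q N * qPoch Q Q (N + a)) +
          Q ^ (N + 1 + a) * (1 / (qPoch Q Q N * qPoch Q Q (N + (a + 1)))) := by
      -- The same splitting of `1 - Q^(N+1)`: the first part is the sum for `(N, a)`, the second,
      -- after a shift of index, the sum for `(N, a + 1)`.
      have split : ∀ p ∈ Finset.HasAntidiagonal.antidiagonal (N + 1),
          Q ^ (p.1 * (p.1 + a)) / (qPoch Q Q p.2 * qPoch Q Q p.1 * qPoch Q Q (p.1 + a)) *
            (1 - Q ^ (N + 1)) =
          Q ^ (p.1 * (p.1 + a)) / (qPoch Q Q p.2 * qPoch Q Q p.1 * qPoch Q Q (p.1 + a)) *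
            (1 - Q ^ p.2) +
          Q ^ (p.1 * (p.1 + a)) / (qPoch Q Q p.2 * qPoch Q Q p.1 * qPoch Q Q (p.1 + a)) *
            (Q ^ p.2 * (1 - Q ^ p.1)) := by
        intro p hp
        rw [← Finset.HasAntidiagonal.mem_antidiagonal.mp hp, pow_add]; ring
      rw [Finset.sum_mul, Finset.sum_congr rfl split, Finset.sum_add_distrib,
        Finset.Nat.sum_antidiagonal_succ', Finset.Nat.sum_antidiagonal_succ (n := N), ← ih,
        ← ih, Finset.mul_sum]
      simp only [pow_zero, sub_self, mul_zero, zero_add]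
      congr 1
      · refine Finset.sum_congr rfl fun p _ => ?_
        rw [qPoch_self_succ]
        have h1 := h0 p.1
        have h2 := h0 p.2
        have h3 := hQ p.2
        have h4 := h0 (p.1 + a)
        field_simp
      · refine Finset.sum_congr rfl fun p hp => ?_
        rw [qPoch_self_succ, ← Finset.HasAntidiagonal.mem_antidiagonal.mp hp,
          show p.1 + 1 + a = p.1 + (a + 1) by ring]
        have h1 := h0 p.1
        have h2 := h0 p.2
        have h3 := hQ p.1
        have h4 := h0 (p.1 + (a + 1))
        field_simp
        ring
    have h1 := h0 N
    have h3 := hQ N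
    have h4 := h0 (N + a)
    have h5 := hQ (N + a)
    rw [← eq_div_iff h3] at key
    rw [key, show N + (a + 1) = N + a + 1 by ring, show N + 1 + a = N + a + 1 by ring,
      qPoch_self_succ, qPoch_self_succ]
    field_simp
    ring

/-- A case of the terminating Bailey lemma, relative to `a = Q` and with both parameters sent to
infinity. -/
theorem bailey_lemma (hQ : ∀ n : ℕ, 1 - Q ^ (n + 1) ≠ 0) (α β : ℕ → K)
    (hαβ : ∀ n, β n = ∑ r ∈ Finset.range (n + 1), α r /
      (qPoch Q Q (n - r) * qPoch Q Q (n + r + 1))) (N : ℕ) :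
    ∑ n ∈ Finset.range (N + 1), Q ^ (n * (n + 1)) * β n / qPoch Q Q (N - n) =
      ∑ r ∈ Finset.range (N + 1), Q ^ (r * (r + 1)) * α r /
        (qPoch Q Q (N - r) * qPoch Q Q (N + r + 1)) := by
  simp only [hαβ, Finset.mul_sum, Finset.sum_div]
  rw [Finset.sum_comm' (t' := Finset.range (N + 1)) (s' := fun r => Finset.Ico r (N + 1))
    (by intro n r; simp only [Finset.mem_range, Finset.mem_Ico]; omega)]
  refine Finset.sum_congr rfl fun r hr => ?_
  have hr : r ≤ N := Nat.lt_succ_iff.mp (Finset.mem_range.mp hr)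
  obtain ⟨M, rfl⟩ := Nat.exists_eq_add_of_le hr
  -- After interchanging summations, the inner sum over `n = r + j` is a Durfee rectangle sum with
  -- `a = 2r + 1`.
  have h := sum_durfee_rectangle hQ M (2 * r + 1)
  rw [Finset.Nat.sum_antidiagonal_eq_sum_range_succ_mk] at h
  rw [Finset.sum_Ico_eq_sum_range, show r + M + 1 - r = M + 1 by omega,
    show r + M - r = M by omega, show r + M + r + 1 = M + (2 * r + 1) by ring,
    div_eq_mul_one_div, ← h, Finset.mul_sum]
  refine Finset.sum_congr rfl fun j hj => ?_
  rw [show r + M - (r + j) = M - j by omega, show r + j - r = j by omega,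
    show r + j + r + 1 = j + (2 * r + 1) by ring,
    show (r + j) * (r + j + 1) = r * (r + 1) + j * (j + (2 * r + 1)) by ring, pow_add]
  ring

/-- Induction on `n`. Put `A_k = 1 + q^(2k+1) + q^(4k+2)`. Then `A_{n+1} = Q^(n+1-r) A_r + (1 -
Q^(n+1-r)) (1 - Q^(n+r+2))` with `Q = q²`. The first part cancels the denominator `A_r` and leaves a
multiple of the unit Bailey sum, which vanishes; the second lowers the Pochhammer symbols to level
`n`. -/
theorem prod_cyclotomic_bailey_pair {q : K} (hq0 : q ≠ 0)
    (hQ : ∀ n : ℕ, 1 - (q ^ 2) ^ (n + 1) ≠ 0)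
    (hA : ∀ k : ℕ, 1 + q ^ (2 * k + 1) + (q ^ (2 * k + 1)) ^ 2 ≠ 0) (n : ℕ) :
    (∏ k ∈ Finset.range (n + 1), (1 + q ^ (2 * k + 1) + (q ^ (2 * k + 1)) ^ 2))⁻¹ =
      ∑ r ∈ Finset.range (n + 1), (-1) ^ r * (q ^ 2) ^ (r + 1).choose 2 *
        (1 - (q ^ 2) ^ (2 * r + 1)) / (1 + q ^ (2 * r + 1) + (q ^ (2 * r + 1)) ^ 2) /
        (qPoch (q ^ 2) (q ^ 2) (n - r) * qPoch (q ^ 2) (q ^ 2) (n + r + 1)) := by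
  have h0 := qPoch_self_ne_zero hQ
  induction n with
  | zero =>
    have h1 := hQ 0
    have h2 := hA 0
    simp only [zero_add, pow_one, mul_zero] at h1 h2
    simp [qPoch]
    field_simp
  | succ n ih =>
    rw [Finset.prod_range_succ, mul_inv, ih, eq_comm, eq_mul_inv_iff_mul_eq₀ (hA (n + 1)),
      Finset.sum_mul]
    have split : ∀ r ∈ Finset.range (n + 1 + 1),
        (-1) ^ r * (q ^ 2) ^ (r + 1).choose 2 * (1 - (q ^ 2) ^ (2 * r + 1)) /
          (1 + q ^ (2 * r + 1) + (q ^ (2 * r + 1)) ^ 2) /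
          (qPoch (q ^ 2) (q ^ 2) (n + 1 - r) * qPoch (q ^ 2) (q ^ 2) (n + 1 + r + 1)) *
          (1 + q ^ (2 * (n + 1) + 1) + (q ^ (2 * (n + 1) + 1)) ^ 2) =
        (q ^ 2) ^ (n + 1) * ((-1) ^ r * (q ^ 2) ^ r.choose 2 * (1 - (q ^ 2) ^ (2 * r + 1)) /
          (qPoch (q ^ 2) (q ^ 2) (n + 1 - r) * qPoch (q ^ 2) (q ^ 2) (n + 1 + r + 1))) +
        (-1) ^ r * (q ^ 2) ^ (r + 1).choose 2 * (1 - (q ^ 2) ^ (2 * r + 1)) /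
          (1 + q ^ (2 * r + 1) + (q ^ (2 * r + 1)) ^ 2) /
          (qPoch (q ^ 2) (q ^ 2) (n + 1 - r) * qPoch (q ^ 2) (q ^ 2) (n + 1 + r + 1)) *
          ((1 - (q ^ 2) ^ (n + 1 - r)) * (1 - (q ^ 2) ^ (n + 1 + r + 1))) := by
      intro r hr
      obtain ⟨s, hs⟩ := Nat.exists_eq_add_of_le (Nat.lt_succ_iff.mp (Finset.mem_range.mp hr))
      rw [hs, show r + s - r = s by omega, Nat.choose_succ_succ' r 1, Nat.choose_one_right]
      have g1 := h0 s
      have g2 := h0 (r + s + r + 1)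
      have g3 := hA r
      field_simp
      ring
    rw [Finset.sum_congr rfl split, Finset.sum_add_distrib, ← Finset.mul_sum,
      sum_unit_bailey_pair (pow_ne_zero 2 hq0) hQ, if_neg (Nat.succ_ne_zero n), mul_zero, zero_add,
      Finset.sum_range_succ]
    simp only [Nat.sub_self, pow_zero, sub_self, zero_mul, mul_zero, add_zero]
    refine Finset.sum_congr rfl fun r hr => ?_
    obtain ⟨s, hs⟩ := Nat.exists_eq_add_of_le (Nat.lt_succ_iff.mp (Finset.mem_range.mp hr))
    have g1 := h0 s
    have g2 := h0 (r + s + r + 1)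
    have g3 := hA r
    have g4 := hQ s
    have g5 := hQ (r + s + r + 1)
    rw [hs, show r + s + 1 - r = s + 1 by omega, show r + s - r = s by omega,
      show r + s + 1 + r + 1 = r + s + r + 1 + 1 by ring, qPoch_self_succ, qPoch_self_succ]
    field_simp

end FiniteIdentities

/-! ### Bailey's lemma as a congruence between partial sums -/

section Truncation

theorem dvd_one_sub_qPoch {R : Type*} [CommRing R] (a q : R) (n : ℕ) : a ∣ 1 - qPoch a q n := by
  induction n with
  | zero => simp [qPoch]
  | succ n ih =>
    rw [qPoch_succ, show 1 - qPoch a q n * (1 - a * q ^ n) =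
      (1 - qPoch a q n) + a * (qPoch a q n * q ^ n) by ring]
    exact dvd_add ih (dvd_mul_right _ _)

theorem qPoch_self_add {R : Type*} [CommRing R] (q : R) (m n : ℕ) :
    qPoch q q (m + n) = qPoch q q m * qPoch (q ^ (m + 1)) q n := by
  rw [qPoch, Finset.prod_range_add, qPoch, qPoch]
  congr 1
  refine Finset.prod_congr rfl fun k _ => ?_
  ring

theorem map_qPoch {R S : Type*} [CommRing R] [CommRing S] (f : R →+* S) (a q : R) (n : ℕ) :
    f (qPoch a q n) = qPoch (f a) (f q) n := by
  simp [qPoch]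

/-- The terminating Bailey lemma, read modulo `Q ^ (N + 1)`. -/
theorem bailey_congruence {R K : Type*} [CommRing R] [Field K] {f : R →+* K}
    (hf : Function.Injective f) (Q : R) (hQ : ∀ n : ℕ, 1 - f Q ^ (n + 1) ≠ 0) (α β : ℕ → R)
    (hαβ : ∀ n, f (β n) = ∑ r ∈ Finset.range (n + 1), f (α r) /
      (qPoch (f Q) (f Q) (n - r) * qPoch (f Q) (f Q) (n + r + 1))) (N : ℕ) :
    Q ^ (N + 1) ∣ qPoch Q Q (2 * N + 1) * ∑ n ∈ Finset.range (N + 1), Q ^ (n * (n + 1)) * β n -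
      ∑ r ∈ Finset.range (N + 1), Q ^ (r * (r + 1)) * α r := by
  have h0 := qPoch_self_ne_zero hQ
  -- `u n = (Q)_N / (Q)_{N-n}` and `v r = (Q)_{2N+1} / (Q)_{N+r+1}` clear the denominators of the
  -- terminating lemma. Both tend to 1: `u n ≡ 1` modulo `Q^(N-n+1)`, and the weight `Q^(n(n+1))`
  -- supplies the missing power.
  let u : ℕ → R := fun n => qPoch (Q ^ (N - n + 1)) Q n
  let v : ℕ → R := fun r => qPoch (Q ^ (N + r + 1 + 1)) Q (N - r)
  have hu : ∀ n ∈ Finset.range (N + 1), qPoch Q Q N = qPoch Q Q (N - n) * u n := by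
    intro n hn
    have hn := Finset.mem_range.mp hn
    rw [← qPoch_self_add]; congr 1; omega
  have hv : ∀ n ∈ Finset.range (N + 1), qPoch Q Q (2 * N + 1) = qPoch Q Q (N + n + 1) * v n := by
    intro n hn
    have hn := Finset.mem_range.mp hn
    rw [← qPoch_self_add]; congr 1; omega
  have exact_eq : qPoch Q Q (2 * N + 1) *
      ∑ n ∈ Finset.range (N + 1), Q ^ (n * (n + 1)) * β n * u n =
      ∑ r ∈ Finset.range (N + 1), Q ^ (r * (r + 1)) * α r * (u r * v r) := by
    apply hf
    have h := congrArg (fun x => f (qPoch Q Q N) * f (qPoch Q Q (2 * N + 1)) * x)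
      (bailey_lemma hQ (fun r => f (α r)) (fun n => f (β n)) hαβ N)
    simp only [Finset.mul_sum] at h
    simp only [Finset.mul_sum, map_sum]
    refine Eq.trans (Finset.sum_congr rfl fun n hn => ?_)
      (h.trans (Finset.sum_congr rfl fun r hr => ?_))
    · rw [hu n hn, map_mul f (qPoch Q Q (N - n)), map_qPoch f Q Q (N - n)]
      have := h0 (N - n)
      simp only [map_mul, map_pow]
      field_simp
    · rw [hu r hr, hv r hr, map_mul f (qPoch Q Q (N - r)), map_mul f (qPoch Q Q (N + r + 1)),
        map_qPoch f Q Q (N - r), map_qPoch f Q Q (N + r + 1)]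
      have h1 := h0 (N - r)
      have h2 := h0 (N + r + 1)
      simp only [map_mul, map_pow]
      field_simp
  have cu : ∀ n ∈ Finset.range (N + 1), Q ^ (N + 1) ∣ Q ^ (n * (n + 1)) * (1 - u n) := by
    intro n hn
    have hn := Finset.mem_range.mp hn
    refine dvd_trans (pow_dvd_pow Q (?_ : N + 1 ≤ n * (n + 1) + (N - n + 1))) ?_
    · have : n ≤ n * (n + 1) := Nat.le_mul_of_pos_right _ (Nat.succ_pos n)
      omega
    · rw [pow_add]
      exact mul_dvd_mul_left _ (dvd_one_sub_qPoch _ _ _)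
  have cv : ∀ n, Q ^ (N + 1) ∣ 1 - v n := fun n =>
    dvd_trans (pow_dvd_pow Q (by omega)) (dvd_one_sub_qPoch _ _ _)
  have e1 : qPoch Q Q (2 * N + 1) * ∑ n ∈ Finset.range (N + 1), Q ^ (n * (n + 1)) * β n -
      ∑ r ∈ Finset.range (N + 1), Q ^ (r * (r + 1)) * α r =
      qPoch Q Q (2 * N + 1) *
        ∑ n ∈ Finset.range (N + 1), β n * (Q ^ (n * (n + 1)) * (1 - u n)) -
      ∑ r ∈ Finset.range (N + 1), (α r * (Q ^ (r * (r + 1)) * (1 - u r)) +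
        Q ^ (r * (r + 1)) * α r * u r * (1 - v r)) := by
    have a1 : ∑ n ∈ Finset.range (N + 1), β n * (Q ^ (n * (n + 1)) * (1 - u n)) =
        ∑ n ∈ Finset.range (N + 1), Q ^ (n * (n + 1)) * β n -
        ∑ n ∈ Finset.range (N + 1), Q ^ (n * (n + 1)) * β n * u n := by
      rw [← Finset.sum_sub_distrib]
      exact Finset.sum_congr rfl fun n _ => by ring
    have a2 : ∑ r ∈ Finset.range (N + 1), (α r * (Q ^ (r * (r + 1)) * (1 - u r)) +
        Q ^ (r * (r + 1)) * α r * u r * (1 - v r)) =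
        ∑ r ∈ Finset.range (N + 1), Q ^ (r * (r + 1)) * α r -
        ∑ r ∈ Finset.range (N + 1), Q ^ (r * (r + 1)) * α r * (u r * v r) := by
      rw [← Finset.sum_sub_distrib]
      exact Finset.sum_congr rfl fun n _ => by ring
    rw [a1, a2, mul_sub, exact_eq]
    ring
  rw [e1]
  refine dvd_sub (dvd_mul_of_dvd_right (Finset.dvd_sum fun n hn =>
    dvd_mul_of_dvd_right (cu n hn) _) _) (Finset.dvd_sum fun r hr => dvd_add
      (dvd_mul_of_dvd_right (cu r hr) _) (dvd_mul_of_dvd_right (cv r) _))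

end Truncation

/-! ### The Lambert-type series for `(q²; q²)_∞ ρ` -/

section IntegerSeries

/-- The partial sums of Euler's pentagonal number series for `(q^2; q^2)_∞`. -/
noncomputable def pentagonalSum (N : ℕ) : ℤ⟦X⟧ :=
  ∑ r ∈ Finset.range (N + 1), (X ^ 2) ^ (r * (r + 1)) *
    ((-1) ^ r * (X ^ 2) ^ r.choose 2 * (1 - (X ^ 2) ^ (2 * r + 1)))

/-- The partial sums of the Lambert-type series for `(q^2; q^2)_∞ ρ^{(3)}(q)`. -/
noncomputable def lambertSum (N : ℕ) : ℤ⟦X⟧ :=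
  ∑ r ∈ Finset.range (N + 1), (X ^ 2) ^ (r * (r + 1)) *
    ((-1) ^ r * (X ^ 2) ^ (r + 1).choose 2 * (1 - (X ^ 2) ^ (2 * r + 1)) *
      invOfUnit (1 + X ^ (2 * r + 1) + (X ^ (2 * r + 1)) ^ 2) 1)

theorem one_add_add_mul_invOfUnit (r : ℕ) :
    (1 + X ^ (2 * r + 1) + (X ^ (2 * r + 1)) ^ 2 : ℤ⟦X⟧) *
      invOfUnit (1 + X ^ (2 * r + 1) + (X ^ (2 * r + 1)) ^ 2) 1 = 1 := by
  apply mul_invOfUnit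
  simp

theorem prod_mul_qPoch (n : ℕ) :
    (∏ k ∈ Finset.range n, (1 + X ^ (2 * k + 1) + (X ^ (2 * k + 1)) ^ 2 : ℤ⟦X⟧)) *
      qPoch X (X ^ 2) n = qPoch (X ^ 3) (X ^ 6) n := by
  rw [qPoch, qPoch, ← Finset.prod_mul_distrib]
  refine Finset.prod_congr rfl fun k _ => ?_
  ring

/-- Both Bailey pairs produce the same prefactor `(Q; Q)_{2N+1}`. The unit pair identifies it with
the pentagonal sum, and substituting this in the congruence for the other pair eliminates it. -/
theorem pentagonalSum_mul_sum_sub_lambertSum (N : ℕ) :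
    (X ^ 2) ^ (N + 1) ∣ pentagonalSum N * ∑ n ∈ Finset.range (N + 1), rhoThreeTerm n -
      lambertSum N := by
  let K := FractionRing ℤ⟦X⟧
  let f : ℤ⟦X⟧ →+* K := algebraMap _ _
  have hf : Function.Injective f := IsFractionRing.injective _ _
  have ne_zero_of : ∀ p : ℤ⟦X⟧, constantCoeff p = 1 → f p ≠ 0 := by
    intro p hp h
    rw [map_eq_zero_iff f hf] at h
    simp [h] at hp
  have hQ : ∀ n : ℕ, 1 - f (X ^ 2) ^ (n + 1) ≠ 0 := by
    intro n
    have := ne_zero_of (1 - (X ^ 2) ^ (n + 1)) (by simp)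
    simpa using this
  have hA : ∀ k : ℕ, 1 + f X ^ (2 * k + 1) + (f X ^ (2 * k + 1)) ^ 2 ≠ 0 := by
    intro n
    have := ne_zero_of (1 + X ^ (2 * n + 1) + (X ^ (2 * n + 1)) ^ 2) (by simp)
    simpa using this
  have hX : f X ≠ 0 := by
    rw [Ne, map_eq_zero_iff f hf]; exact X_ne_zero
  have h1 := bailey_congruence hf (X ^ 2) hQ
    (fun r => (-1) ^ r * (X ^ 2) ^ r.choose 2 * (1 - (X ^ 2) ^ (2 * r + 1)))
    (fun n => if n = 0 then 1 else 0) (fun n => by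
      have h := sum_unit_bailey_pair (Q := f (X ^ 2)) (by simpa using hX) hQ n
      simp only [map_mul, map_pow, map_neg, map_one, map_sub] at h ⊢
      rw [h]; split_ifs <;> simp) N
  have h2 := bailey_congruence hf (X ^ 2) hQ
    (fun r => (-1) ^ r * (X ^ 2) ^ (r + 1).choose 2 * (1 - (X ^ 2) ^ (2 * r + 1)) *
      invOfUnit (1 + X ^ (2 * r + 1) + (X ^ (2 * r + 1)) ^ 2) 1)
    (fun n => qPoch (X : ℤ⟦X⟧) (X ^ 2) (n + 1) *
      invOfUnit (qPoch ((X : ℤ⟦X⟧) ^ 3) (X ^ 6) (n + 1)) 1) (fun n => by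
      have h := prod_cyclotomic_bailey_pair hX (by simpa using hQ) hA n
      have e : (∏ k ∈ Finset.range (n + 1), (1 + X ^ (2 * k + 1) + (X ^ (2 * k + 1)) ^ 2 : ℤ⟦X⟧)) *
          (qPoch X (X ^ 2) (n + 1) * invOfUnit (qPoch (X ^ 3) (X ^ 6) (n + 1)) 1) = 1 := by
        rw [← mul_assoc, prod_mul_qPoch, qPoch_mul_invOfUnit]
      replace e := congrArg f e
      rw [map_mul, map_one] at e
      rw [eq_inv_of_mul_eq_one_right e, map_prod]
      simp only [map_mul, map_pow, map_neg, map_one, map_sub, map_add] at h ⊢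
      rw [h]
      refine Finset.sum_congr rfl fun r _ => ?_
      have e2 := congrArg f (one_add_add_mul_invOfUnit r)
      rw [map_mul, map_one] at e2
      rw [eq_inv_of_mul_eq_one_right e2]
      simp only [map_pow, map_one, map_add]
      rw [div_eq_mul_inv (_ * _)]) N
  have e : ∑ n ∈ Finset.range (N + 1), (X ^ 2 : ℤ⟦X⟧) ^ (n * (n + 1)) *
      (if n = 0 then 1 else 0) = 1 := by
    rw [Finset.sum_eq_single 0] <;> simp
  have e' : ∑ n ∈ Finset.range (N + 1), (X ^ 2 : ℤ⟦X⟧) ^ (n * (n + 1)) *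
      (qPoch (X : ℤ⟦X⟧) (X ^ 2) (n + 1) *
        invOfUnit (qPoch ((X : ℤ⟦X⟧) ^ 3) (X ^ 6) (n + 1)) 1) =
      ∑ n ∈ Finset.range (N + 1), rhoThreeTerm n := by
    refine Finset.sum_congr rfl fun n _ => ?_
    rw [rhoThreeTerm, ← pow_mul]
    ring_nf
  rw [e, mul_one, ← pentagonalSum] at h1
  rw [e', ← lambertSum] at h2
  have := dvd_sub h2 (dvd_mul_of_dvd_left h1 (∑ n ∈ Finset.range (N + 1), rhoThreeTerm n))
  convert this using 1
  ring

end IntegerSeries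

/-! ### Reduction modulo 2 and divisor counts -/

section ModTwo

/-- The series `∑_{m ≡ ±1 (6), m > 0} q^{(m^2 - 1) / 12}` modulo `2`. -/
noncomputable def pentagonalIndicator : (ZMod 2)⟦X⟧ :=
  PowerSeries.mk fun i => if IsSquare (12 * i + 1) then 1 else 0

/-- The series counting the divisors `t` of `12 i + 9` with `3 ∣ t`, `t^2 ≤ 12 i + 9` and
cofactor prime to `3`, corrected at squares, modulo `2`. -/
noncomputable def smallDivisorSeries : (ZMod 2)⟦X⟧ :=
  PowerSeries.mk fun i =>
    ((((12 * i + 9).divisors.filter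
      fun t => 3 ∣ t ∧ t * t ≤ 12 * i + 9 ∧ ¬ 3 ∣ (12 * i + 9) / t).card : ℕ) : ZMod 2) +
    if IsSquare (12 * i + 9) then 1 else 0

/-- The generating series of half the number of divisors of `3 n + 2`, modulo `2`. -/
noncomputable def halfDivisorSeries : (ZMod 2)⟦X⟧ :=
  PowerSeries.mk fun n => (((3 * n + 2).divisors.filter fun d => d % 3 = 1).card : ZMod 2)

/-- The series `∑_{3 ∤ j} q^{m j}` modulo `2`. -/
noncomputable def notDvdThreeSeries (m : ℕ) : (ZMod 2)⟦X⟧ :=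
  PowerSeries.mk fun i => if m ∣ i ∧ ¬ 3 ∣ i / m then 1 else 0

instance charP_two_powerSeries : CharP (ZMod 2)⟦X⟧ 2 :=
  charP_of_injective_ringHom (f := C (R := ZMod 2)) C_injective 2

theorem zmod_two_neg_one : (-1 : (ZMod 2)⟦X⟧) = 1 := CharTwo.neg_eq 1

/-- For `j ≥ 2`, exactly two of `j, j - 1, j - 2` are prime to 3, so these coefficients cancel
modulo 2. -/
theorem one_add_add_mul_notDvdThreeSeries {m : ℕ} (hm : 0 < m) :
    (1 + X ^ m + (X ^ m) ^ 2) * notDvdThreeSeries m = X ^ m := by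
  ext i
  rw [← pow_mul, add_mul, add_mul, one_mul, map_add, map_add, coeff_X_pow_mul', coeff_X_pow_mul',
    coeff_X_pow]
  simp only [notDvdThreeSeries, coeff_mk]
  by_cases hd : m ∣ i
  · obtain ⟨j, rfl⟩ := hd
    have h1 : m * j - m = m * (j - 1) := by rw [Nat.mul_sub, mul_one]
    have h2 : m * j - m * 2 = m * (j - 2) := by rw [Nat.mul_sub]
    rw [h1, h2]
    simp only [Nat.mul_div_cancel_left _ hm, dvd_mul_right, true_and, Nat.mul_le_mul_left_iff hm,
      le_mul_iff_one_le_right hm, Nat.mul_eq_left hm.ne']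
    by_cases c0 : j = 0
    · subst c0; simp
    by_cases c1 : j = 1
    · subst c1; simp
    have c2 : 2 ≤ j := by omega
    rw [if_pos (by omega : 1 ≤ j), if_pos c2, if_neg c1]
    have : j % 3 = 0 ∨ j % 3 = 1 ∨ j % 3 = 2 := by omega
    rcases this with h | h | h
    · rw [if_neg (by omega), if_pos (by omega), if_pos (by omega)]; decide
    · rw [if_pos (by omega), if_neg (by omega), if_pos (by omega)]; decide
    · rw [if_pos (by omega), if_pos (by omega), if_neg (by omega)]; decide
  · have n1 : i ≠ m := fun h => hd (h ▸ dvd_rfl)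
    have n2 : m ≤ i → ¬ m ∣ i - m := fun h => fun h' =>
      hd ((Nat.dvd_sub_iff_left h dvd_rfl).mp h')
    have n3 : m * 2 ≤ i → ¬ m ∣ i - m * 2 := fun h h' =>
      hd ((Nat.dvd_sub_iff_left h (dvd_mul_right m 2)).mp h')
    rw [if_neg (by tauto), if_neg n1]
    split_ifs <;> first | rfl | tauto

/-- With `x = q^(2r+1)`, modulo 2 one has `1 - x² = (1 + x + x²) + x`, and `x / (1 + x + x²)` is the
series over exponents prime to 3. -/
theorem map_one_sub_mul_invOfUnit (r : ℕ) :
    PowerSeries.map (Int.castRingHom (ZMod 2)) ((1 - (X ^ 2) ^ (2 * r + 1)) *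
      invOfUnit (1 + X ^ (2 * r + 1) + (X ^ (2 * r + 1)) ^ 2) 1) =
      1 + notDvdThreeSeries (2 * r + 1) := by
  have h := congrArg (PowerSeries.map (Int.castRingHom (ZMod 2))) (one_add_add_mul_invOfUnit r)
  have h' := one_add_add_mul_notDvdThreeSeries (m := 2 * r + 1) (Nat.succ_pos (2 * r))
  simp only [map_mul, map_sub, map_add, map_one, map_pow, PowerSeries.map_X] at h ⊢
  have h2 : (2 : (ZMod 2)⟦X⟧) = 0 := CharTwo.two_eq_zero
  set J := PowerSeries.map (Int.castRingHom (ZMod 2))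
    (invOfUnit (1 + X ^ (2 * r + 1) + (X ^ (2 * r + 1)) ^ 2) 1)
  have : (1 - (X ^ 2) ^ (2 * r + 1) : (ZMod 2)⟦X⟧) =
      (1 + X ^ (2 * r + 1) + (X ^ (2 * r + 1)) ^ 2) * (1 + notDvdThreeSeries (2 * r + 1)) := by
    rw [mul_add, h', ← pow_mul, ← pow_mul, mul_comm 2]
    linear_combination (- X ^ ((2 * r + 1) * 2) - X ^ (2 * r + 1)) * h2
  rw [this]
  linear_combination (1 + notDvdThreeSeries (2 * r + 1)) * h

theorem map_pentagonalSum (N : ℕ) :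
    PowerSeries.map (Int.castRingHom (ZMod 2)) (pentagonalSum N) =
      ∑ r ∈ Finset.range (N + 1), (X ^ (r * (3 * r + 1)) + X ^ ((r + 1) * (3 * r + 2))) := by
  rw [pentagonalSum, map_sum]
  refine Finset.sum_congr rfl fun r _ => ?_
  simp only [map_mul, map_sub, map_one, map_pow, PowerSeries.map_X, map_neg]
  have e1 : 2 * (r * (r + 1)) + 2 * r.choose 2 = r * (3 * r + 1) := by
    linarith [two_mul_choose_two_add r]
  have e2 : r * (3 * r + 1) + 2 * (2 * r + 1) = (r + 1) * (3 * r + 2) := by ring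
  rw [zmod_two_neg_one, one_pow, one_mul, ← pow_mul, ← pow_mul, ← pow_mul, ← mul_assoc, ← pow_add,
    e1, mul_sub, ← pow_add, e2, mul_one, CharTwo.sub_eq_add]

theorem map_lambertSum (N : ℕ) :
    PowerSeries.map (Int.castRingHom (ZMod 2)) (lambertSum N) =
      ∑ r ∈ Finset.range (N + 1), X ^ (3 * (r * (r + 1))) *
        (1 + notDvdThreeSeries (2 * r + 1)) := by
  rw [lambertSum, map_sum]
  refine Finset.sum_congr rfl fun r _ => ?_
  have e1 : 2 * (r * (r + 1)) + 2 * (r + 1).choose 2 = 3 * (r * (r + 1)) := by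
    linarith [two_mul_choose_two_add (r + 1)]
  rw [mul_assoc ((-1) ^ r * _), map_mul, map_mul, map_one_sub_mul_invOfUnit]
  simp only [map_mul, map_one, map_pow, PowerSeries.map_X, map_neg]
  rw [zmod_two_neg_one, one_pow, one_mul, ← mul_assoc, ← pow_mul, ← pow_mul, ← pow_add, e1]

/-- For the exponents `i = r(3r+1)` and `i = (r+1)(3r+2)`, `12 i + 1` equals `(6r+1)²` and
`(6r+5)²`, so each square is met once. -/
theorem coeff_map_pentagonalSum {i N : ℕ} (hi : i ≤ N) :
    coeff i (PowerSeries.map (Int.castRingHom (ZMod 2)) (pentagonalSum N)) =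
      coeff i pentagonalIndicator := by
  rw [map_pentagonalSum, map_sum, pentagonalIndicator, coeff_mk]
  simp only [map_add, coeff_X_pow]
  split_ifs with h
  · obtain ⟨s, hs⟩ := h
    have hs6 : s % 6 = 1 ∨ s % 6 = 5 := by
      have : s % 6 < 6 := Nat.mod_lt _ (by norm_num)
      have h6 : (s % 6) * (s % 6) % 6 = 1 := by rw [← Nat.mul_mod, ← hs]; omega
      interval_cases s % 6 <;> omega
    obtain ⟨r, hr⟩ : ∃ r, r = s / 6 := ⟨_, rfl⟩
    have hrN : r ∈ Finset.range (N + 1) := by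
      rw [Finset.mem_range]
      by_contra! hlt
      have : 6 * r ≤ s := by omega
      nlinarith
    rw [Finset.sum_eq_single_of_mem r hrN]
    · rcases hs6 with h | h
      · have : s = 6 * r + 1 := by omega
        subst this
        rw [if_pos (by nlinarith), if_neg (by nlinarith), add_zero]
      · have : s = 6 * r + 5 := by omega
        subst this
        rw [if_neg (by nlinarith), if_pos (by nlinarith), zero_add]
    · intro b _ hb
      rw [if_neg, if_neg, add_zero]
      · intro h
        have : s * s = (6 * b + 5) * (6 * b + 5) := by rw [← hs, h]; ring
        have := Nat.mul_self_inj.mp this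
        omega
      · intro h
        have : s * s = (6 * b + 1) * (6 * b + 1) := by rw [← hs, h]; ring
        have := Nat.mul_self_inj.mp this
        omega
  · refine Finset.sum_eq_zero fun r _ => ?_
    rw [if_neg, if_neg, add_zero]
    · rintro rfl
      exact h ⟨6 * r + 5, by ring⟩
    · rintro rfl
      exact h ⟨6 * r + 1, by ring⟩

theorem coeff_map_lambertSum {i N : ℕ} (hi : i ≤ N) :
    coeff i (PowerSeries.map (Int.castRingHom (ZMod 2)) (lambertSum N)) =
      coeff i smallDivisorSeries := by
  rw [map_lambertSum, map_sum, smallDivisorSeries, coeff_mk]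
  have split : ∀ r, coeff i (X ^ (3 * (r * (r + 1))) * (1 + notDvdThreeSeries (2 * r + 1))) =
      coeff i (X ^ (3 * (r * (r + 1)))) +
        coeff i (X ^ (3 * (r * (r + 1))) * notDvdThreeSeries (2 * r + 1)) := by
    intro r
    rw [mul_one_add, map_add]
  simp only [split, Finset.sum_add_distrib]
  rw [add_comm (∑ r ∈ Finset.range (N + 1), coeff i (X ^ (3 * (r * (r + 1)))))]
  congr 1
  · have : ∀ r, coeff i (X ^ (3 * (r * (r + 1))) * notDvdThreeSeries (2 * r + 1)) =
        if 3 * (r * (r + 1)) ≤ i ∧ (2 * r + 1) ∣ i - 3 * (r * (r + 1)) ∧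
          ¬ 3 ∣ (i - 3 * (r * (r + 1))) / (2 * r + 1) then 1 else 0 := by
      intro r
      rw [coeff_X_pow_mul', notDvdThreeSeries, coeff_mk]
      split_ifs <;> first | rfl | tauto
    simp only [this]
    rw [Finset.sum_boole]
    congr 1
    -- The substitution `t = 3(2r+1)` with cofactor `t + 4j` matches pairs `(r, j)` with divisors `t
    -- ≤ √(12i+9)`; since `3 ∣ t`, `3 ∤ j` says that the cofactor is prime to 3.
    have cof : ∀ r j, i = 3 * (r * (r + 1)) + (2 * r + 1) * j →
        12 * i + 9 = 3 * (2 * r + 1) * (3 * (2 * r + 1) + 4 * j) := by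
      rintro r j rfl; ring
    refine Finset.card_bij (fun r _ => 3 * (2 * r + 1)) ?_ (fun a _ b _ h => by omega) ?_
    · intro r hr
      obtain ⟨-, hle, ⟨j, hj⟩, h3⟩ := Finset.mem_filter.mp hr
      rw [hj, Nat.mul_div_cancel_left _ (Nat.succ_pos _)] at h3
      have hc := cof r j (by omega)
      rw [Finset.mem_filter, Nat.mem_divisors]
      refine ⟨⟨⟨_, hc⟩, by omega⟩, ⟨_, rfl⟩, ?_, ?_⟩
      · rw [hc]; exact Nat.mul_le_mul_left _ (Nat.le_add_right _ _)
      · rw [hc, Nat.mul_div_cancel_left _ (by omega)]; omega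
    · intro t ht
      obtain ⟨hd, ⟨m, rfl⟩, hle, h3⟩ := Finset.mem_filter.mp ht
      obtain ⟨e, he⟩ := Nat.dvd_of_mem_divisors hd
      have hm0 : 0 < 3 * m := Nat.pos_of_mem_divisors hd
      rw [he, Nat.mul_div_cancel_left _ hm0] at h3
      have hme : 4 * i + 3 = m * e := by
        have : 3 * (4 * i + 3) = 3 * (m * e) := by rw [← mul_assoc, ← he]; ring
        omega
      have hodd : m % 2 = 1 ∧ e % 4 = 3 * m % 4 := by
        have h4 : (m % 4) * (e % 4) % 4 = 3 := by rw [← Nat.mul_mod, ← hme]; omega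
        have l1 : m % 4 < 4 := Nat.mod_lt _ (by norm_num)
        have l2 : e % 4 < 4 := Nat.mod_lt _ (by norm_num)
        constructor
        · by_contra hc
          have : m % 4 = 0 ∨ m % 4 = 2 := by omega
          rcases this with h | h <;> rw [h] at h4 <;> omega
        · have : m % 4 = 0 ∨ m % 4 = 1 ∨ m % 4 = 2 ∨ m % 4 = 3 := by omega
          rcases this with h | h | h | h <;> rw [h] at h4 <;> omega
      obtain ⟨r, rfl⟩ : ∃ r, m = 2 * r + 1 := ⟨m / 2, by omega⟩
      have hle' : 3 * (2 * r + 1) ≤ e := by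
        rw [he] at hle
        exact Nat.le_of_mul_le_mul_left hle hm0
      obtain ⟨j, rfl⟩ : ∃ j, e = 3 * (2 * r + 1) + 4 * j := ⟨(e - 3 * (2 * r + 1)) / 4, by omega⟩
      have hi' : i = 3 * (r * (r + 1)) + (2 * r + 1) * j := by
        nlinarith
      refine ⟨r, ?_, rfl⟩
      rw [Finset.mem_filter, Finset.mem_range]
      have hsub : i - 3 * (r * (r + 1)) = (2 * r + 1) * j := by omega
      refine ⟨?_, by omega, ⟨j, hsub⟩, ?_⟩
      · nlinarith
      · rw [hsub, Nat.mul_div_cancel_left _ (Nat.succ_pos _)]; omega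
  -- The terms `q^(3r(r+1))` give the square correction: `12 · 3r(r+1) + 9 = (6r+3)²`.
  · simp only [coeff_X_pow]
    split_ifs with h
    · obtain ⟨s, hs⟩ := h
      have hs6 : s % 6 = 3 := by
        have : s % 6 < 6 := Nat.mod_lt _ (by norm_num)
        have h6 : (s % 6) * (s % 6) % 6 = 3 := by rw [← Nat.mul_mod, ← hs]; omega
        interval_cases s % 6 <;> omega
      obtain ⟨r, rfl⟩ : ∃ r, s = 6 * r + 3 := ⟨s / 6, by omega⟩
      rw [Finset.sum_eq_single_of_mem r]
      · rw [if_pos (by nlinarith)]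
      · rw [Finset.mem_range]; nlinarith
      · intro b _ hb
        rw [if_neg]
        intro h
        have : (6 * r + 3) * (6 * r + 3) = (6 * b + 3) * (6 * b + 3) := by rw [← hs, h]; ring
        have := Nat.mul_self_inj.mp this
        omega
    · refine Finset.sum_eq_zero fun r _ => if_neg ?_
      rintro rfl
      exact h ⟨6 * r + 3, by ring⟩

theorem X_pow_dvd_sub_of_coeff_eq {R : Type*} [CommRing R] {f g : R⟦X⟧} {N : ℕ}
    (h : ∀ i ≤ N, coeff i f = coeff i g) : X ^ (N + 1) ∣ f - g := by
  rw [X_pow_dvd_iff]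
  intro i hi
  rw [map_sub, h i (Nat.lt_succ_iff.mp hi), sub_self]

theorem coeff_sum_rhoThreeTerm {i N : ℕ} (hi : i ≤ N) :
    coeff i (∑ n ∈ Finset.range (N + 1), rhoThreeTerm n) = coeff i rhoThree := by
  rw [coeff_rhoThree, map_sum]
  symm
  refine Finset.sum_subset (Finset.range_subset_range.mpr (by omega)) fun n _ hn => ?_
  apply coeff_rhoThreeTerm_eq_zero
  simp only [Finset.mem_range, not_lt] at hn
  nlinarith

theorem pentagonalIndicator_mul_rhoThree :
    pentagonalIndicator * PowerSeries.map (Int.castRingHom (ZMod 2)) rhoThree =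
      smallDivisorSeries := by
  let φ := PowerSeries.map (Int.castRingHom (ZMod 2))
  ext i
  have h1 : X ^ (i + 1) ∣ φ (pentagonalSum i) - pentagonalIndicator :=
    X_pow_dvd_sub_of_coeff_eq fun j hj => coeff_map_pentagonalSum hj
  have h2 : X ^ (i + 1) ∣ φ (lambertSum i) - smallDivisorSeries :=
    X_pow_dvd_sub_of_coeff_eq fun j hj => coeff_map_lambertSum hj
  have h3 : X ^ (i + 1) ∣ φ (∑ n ∈ Finset.range (i + 1), rhoThreeTerm n) - φ rhoThree :=
    X_pow_dvd_sub_of_coeff_eq fun j hj => by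
      simp only [φ, PowerSeries.coeff_map, coeff_sum_rhoThreeTerm hj]
  have h4 : X ^ (i + 1) ∣ φ (pentagonalSum i) * φ (∑ n ∈ Finset.range (i + 1), rhoThreeTerm n) -
      φ (lambertSum i) := by
    have := map_dvd φ (pentagonalSum_mul_sum_sub_lambertSum i)
    rw [map_sub, map_mul, map_pow, map_pow, PowerSeries.map_X, ← pow_mul] at this
    exact dvd_trans (pow_dvd_pow X (by omega)) this
  have h5 : X ^ (i + 1) ∣ pentagonalIndicator * φ rhoThree - smallDivisorSeries := by
    have := dvd_sub (dvd_add h4 h2) (dvd_add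
      (dvd_mul_of_dvd_left h1 (φ (∑ n ∈ Finset.range (i + 1), rhoThreeTerm n)))
      (dvd_mul_of_dvd_right h3 pentagonalIndicator))
    convert this using 1
    ring
  have := X_pow_dvd_iff.mp h5 i (Nat.lt_succ_self i)
  rwa [map_sub, sub_eq_zero] at this

end ModTwo

/-! ### Windmills, sign changes of quadratic polynomials, and the parity recurrence -/

section Windmill

/-- Triples `(s, d, e)` with `d, e > 0`, `s ≡ d ≡ 1`, `e ≡ 2 (mod 3)` and `s^2 + 4 d e = D`. -/
noncomputable def windmills (D : ℤ) : Finset (ℤ × ℤ × ℤ) :=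
  (Finset.Icc (-D) D ×ˢ Finset.Icc 1 D ×ˢ Finset.Icc 1 D).filter fun x =>
    x.1 % 3 = 1 ∧ x.2.1 % 3 = 1 ∧ x.2.2 % 3 = 2 ∧ x.1 ^ 2 + 4 * x.2.1 * x.2.2 = D

/-- Triples `(t, b, c)` with `t, c > 0`, `3 ∣ t`, `3 ∤ c`, `b^2 + 4 t c = D` and `b + c < t`. -/
noncomputable def signChanges (D : ℤ) : Finset (ℤ × ℤ × ℤ) :=
  (Finset.Icc 1 D ×ˢ Finset.Icc (-D) D ×ˢ Finset.Icc 1 D).filter fun x =>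
    x.1 % 3 = 0 ∧ x.2.2 % 3 ≠ 0 ∧ x.2.1 ^ 2 + 4 * x.1 * x.2.2 = D ∧ x.2.1 + x.2.2 < x.1

theorem bounds_of_sq_add_four_mul {D s d e : ℤ} (hd : 0 < d) (he : 0 < e)
    (h : s ^ 2 + 4 * d * e = D) : -D ≤ s ∧ s ≤ D ∧ d ≤ D ∧ e ≤ D := by
  have h1 : 0 < d * e := mul_pos hd he
  have h2 : s ≤ s ^ 2 := Int.le_self_sq s
  have h3 : -s ≤ s ^ 2 := by simpa using Int.le_self_sq (-s)
  have h4 : d ≤ d * e := le_mul_of_one_le_right hd.le he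
  have h5 : e ≤ d * e := le_mul_of_one_le_left he.le hd
  have h6 := sq_nonneg s
  refine ⟨?_, ?_, ?_, ?_⟩ <;> linarith

theorem mem_windmills {D s d e : ℤ} : (s, d, e) ∈ windmills D ↔
    0 < d ∧ 0 < e ∧ s % 3 = 1 ∧ d % 3 = 1 ∧ e % 3 = 2 ∧ s ^ 2 + 4 * d * e = D := by
  simp only [windmills, Finset.mem_filter, Finset.mem_product, Finset.mem_Icc]
  constructor
  · rintro ⟨⟨-, ⟨hd, -⟩, ⟨he, -⟩⟩, h⟩
    exact ⟨hd, he, h⟩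
  · rintro ⟨hd, he, h⟩
    obtain ⟨h1, h2, h3, h4⟩ := bounds_of_sq_add_four_mul hd he h.2.2.2
    exact ⟨⟨⟨h1, h2⟩, ⟨hd, h3⟩, ⟨he, h4⟩⟩, h⟩

theorem mem_signChanges {D t b c : ℤ} : (t, b, c) ∈ signChanges D ↔
    0 < t ∧ 0 < c ∧ t % 3 = 0 ∧ c % 3 ≠ 0 ∧ b ^ 2 + 4 * t * c = D ∧ b + c < t := by
  simp only [signChanges, Finset.mem_filter, Finset.mem_product, Finset.mem_Icc]
  constructor
  · rintro ⟨⟨⟨hd, -⟩, -, ⟨he, -⟩⟩, h⟩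
    exact ⟨hd, he, h⟩
  · rintro ⟨hd, he, h⟩
    obtain ⟨h1, h2, h3, h4⟩ := bounds_of_sq_add_four_mul hd he h.2.2.1
    exact ⟨⟨⟨hd, h3⟩, ⟨h1, h2⟩, ⟨he, h4⟩⟩, h⟩

theorem emod_three_eq_zero_of_sq_add {D t b c : ℤ} (hD : D % 3 = 0) (ht : t % 3 = 0)
    (h : b ^ 2 + 4 * t * c = D) : b % 3 = 0 := by
  obtain ⟨t, rfl⟩ := Int.dvd_of_emod_eq_zero ht
  obtain ⟨D, rfl⟩ := Int.dvd_of_emod_eq_zero hD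
  have : (3 : ℤ) ∣ b ^ 2 := ⟨D - 4 * t * c, by linarith⟩
  exact Int.emod_eq_zero_of_dvd (Int.prime_three.dvd_of_dvd_pow this)

/-- Let `F(X, Y) = d X² + s X Y - e Y²`, so `F(1, 1) = d + s - e`. If this is positive, `F(X, X + Y)
= t X² + b X Y - c Y²` has `c = e`, and `t - b - c = d > 0`. Since `3 ∣ b`, the residues of `s, d,
e` modulo 3 correspond to `c ≡ 2`. -/
theorem card_windmills_pos {D : ℤ} (hD : D % 3 = 0) :
    ((windmills D).filter fun x => 0 < x.2.1 + x.1 - x.2.2).card =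
      ((signChanges D).filter fun x => x.2.2 % 3 = 2).card := by
  refine Finset.card_nbij' (fun x => (x.2.1 + x.1 - x.2.2, x.1 - 2 * x.2.2, x.2.2))
    (fun y => (y.2.1 + 2 * y.2.2, y.1 - y.2.1 - y.2.2, y.2.2)) ?_ ?_ ?_ ?_
  · rintro ⟨s, d, e⟩ hx
    simp only [Finset.coe_filter, Set.mem_ofPred_eq, mem_windmills, mem_signChanges] at hx ⊢
    obtain ⟨⟨hd, he, hs3, hd3, he3, h⟩, ht⟩ := hx
    refine ⟨⟨ht, he, by omega, by omega, by linear_combination h, by omega⟩, he3⟩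
  · rintro ⟨t, b, c⟩ hx
    simp only [Finset.coe_filter, Set.mem_ofPred_eq, mem_windmills, mem_signChanges] at hx ⊢
    obtain ⟨⟨ht, hc, ht3, hc3, h, hlt⟩, hc2⟩ := hx
    have hb := emod_three_eq_zero_of_sq_add hD ht3 h
    refine ⟨⟨by omega, hc, by omega, by omega, hc2, by linear_combination h⟩, by omega⟩
  · rintro ⟨s, d, e⟩ -
    simp only [Prod.mk.injEq, and_true]
    constructor <;> ring
  · rintro ⟨t, b, c⟩ -
    simp only [Prod.mk.injEq, and_true]
    constructor <;> ring

/-- The mirror case `F(1, 1) < 0`, using `-F(X + Y, X)`: now `c = d ≡ 1 (mod 3)` and `t - b - c =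
e`. The residue of `c` separates the two cases. -/
theorem card_windmills_neg {D : ℤ} (hD : D % 3 = 0) :
    ((windmills D).filter fun x => x.2.1 + x.1 - x.2.2 < 0).card =
      ((signChanges D).filter fun x => ¬ x.2.2 % 3 = 2).card := by
  refine Finset.card_nbij' (fun x => (x.2.2 - x.1 - x.2.1, - x.1 - 2 * x.2.1, x.2.1))
    (fun y => (- y.2.1 - 2 * y.2.2, y.2.2, y.1 - y.2.1 - y.2.2)) ?_ ?_ ?_ ?_
  · rintro ⟨s, d, e⟩ hx
    simp only [Finset.coe_filter, Set.mem_ofPred_eq, mem_windmills, mem_signChanges] at hx ⊢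
    obtain ⟨⟨hd, he, hs3, hd3, he3, h⟩, ht⟩ := hx
    refine ⟨⟨by omega, hd, by omega, by omega, by linear_combination h, by omega⟩, by omega⟩
  · rintro ⟨t, b, c⟩ hx
    simp only [Finset.coe_filter, Set.mem_ofPred_eq, mem_windmills, mem_signChanges] at hx ⊢
    obtain ⟨⟨ht, hc, ht3, hc3, h, hlt⟩, hc2⟩ := hx
    have hb := emod_three_eq_zero_of_sq_add hD ht3 h
    refine ⟨⟨hc, by omega, by omega, by omega, by omega, by linear_combination h⟩, by omega⟩
  · rintro ⟨s, d, e⟩ -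
    simp only [Prod.mk.injEq, true_and]
    constructor <;> ring
  · rintro ⟨t, b, c⟩ -
    simp only [Prod.mk.injEq, and_true]
    constructor <;> ring

/-- If `e = d + s` then `D = (d + e)²`. For `√D = 6k + 3`, the choices `d ≡ 1 (mod 3)` below `√D`
number `2k + 1`, which is odd. -/
theorem card_windmills_zero (N : ℕ) :
    ((((windmills (12 * N + 9)).filter fun x => x.2.1 + x.1 - x.2.2 = 0).card : ℕ) : ZMod 2) =
      if IsSquare (12 * N + 9) then 1 else 0 := by
  split_ifs with h
  · obtain ⟨r, hr⟩ := h
    have hr6 : r % 6 = 3 := by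
      have : r % 6 < 6 := Nat.mod_lt _ (by norm_num)
      have h6 : (r % 6) * (r % 6) % 6 = 3 := by rw [← Nat.mul_mod, ← hr]; omega
      interval_cases r % 6 <;> omega
    obtain ⟨k, rfl⟩ : ∃ k, r = 6 * k + 3 := ⟨r / 6, by omega⟩
    have hD : (12 * N + 9 : ℤ) = (6 * k + 3) * (6 * k + 3) := by exact_mod_cast hr
    have : ((windmills (12 * N + 9)).filter fun x => x.2.1 + x.1 - x.2.2 = 0).card =
        (Finset.range (2 * k + 1)).card := by
      refine (Finset.card_bij (fun (x : ℕ) _ => ((6 * k + 3 - 2 * (3 * x + 1) : ℤ),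
        (3 * x + 1 : ℤ), (6 * k + 3 - (3 * x + 1) : ℤ))) ?_ ?_ ?_).symm
      · intro x hx
        have hx := Finset.mem_range.mp hx
        simp only [Finset.mem_filter, mem_windmills]
        refine ⟨⟨by omega, by omega, by omega, by omega, by omega, ?_⟩, by ring⟩
        rw [hD]; ring
      · intro x _ y _ h
        simp only [Prod.mk.injEq] at h
        omega
      · rintro ⟨s, d, e⟩ hx
        simp only [Finset.mem_filter, mem_windmills] at hx
        obtain ⟨⟨hd, he, hs3, hd3, he3, h⟩, ht⟩ := hx
        have hsq : (d + e) * (d + e) = (6 * k + 3) * (6 * k + 3) := by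
          rw [← hD, ← h, show s = e - d by omega]; ring
        have hde : d + e = 6 * k + 3 := by
          rcases mul_self_eq_mul_self_iff.mp hsq with h | h <;> omega
        refine ⟨(d / 3).toNat, Finset.mem_range.mpr (by omega), ?_⟩
        simp only [Prod.mk.injEq]
        omega
    rw [this, Finset.card_range]
    push_cast
    rw [show (2 : ZMod 2) = 0 from rfl]; ring
  · rw [Finset.card_eq_zero.mpr, Nat.cast_zero]
    rw [Finset.filter_eq_empty_iff]
    rintro ⟨s, d, e⟩ hx ht
    obtain ⟨hd, he, hs3, hd3, he3, hx⟩ := mem_windmills.mp hx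
    simp only at ht
    refine h ⟨(d + e).toNat, ?_⟩
    zify
    rw [Int.toNat_of_nonneg (by omega), ← hx, show s = e - d by omega]
    ring

theorem card_windmills_eq (N : ℕ) :
    ((windmills (12 * N + 9)).card : ZMod 2) = ((signChanges (12 * N + 9)).card : ZMod 2) +
      if IsSquare (12 * N + 9) then 1 else 0 := by
  have hD : (12 * N + 9 : ℤ) % 3 = 0 := by omega
  have e1 := Finset.card_filter_add_card_filter_not (s := windmills (12 * N + 9))
    (fun x => 0 < x.2.1 + x.1 - x.2.2)
  have e2 := Finset.card_filter_add_card_filter_not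
    (s := (windmills (12 * N + 9)).filter fun x => ¬ 0 < x.2.1 + x.1 - x.2.2)
    (fun x => x.2.1 + x.1 - x.2.2 = 0)
  have e3 := Finset.card_filter_add_card_filter_not (s := signChanges (12 * N + 9))
    (fun x => x.2.2 % 3 = 2)
  have f1 : ((windmills (12 * N + 9)).filter fun x => ¬ 0 < x.2.1 + x.1 - x.2.2).filter
      (fun x => x.2.1 + x.1 - x.2.2 = 0) =
      (windmills (12 * N + 9)).filter fun x => x.2.1 + x.1 - x.2.2 = 0 := by
    rw [Finset.filter_filter]
    exact Finset.filter_congr fun x _ => by omega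
  have f2 : ((windmills (12 * N + 9)).filter fun x => ¬ 0 < x.2.1 + x.1 - x.2.2).filter
      (fun x => ¬ x.2.1 + x.1 - x.2.2 = 0) =
      (windmills (12 * N + 9)).filter fun x => x.2.1 + x.1 - x.2.2 < 0 := by
    rw [Finset.filter_filter]
    exact Finset.filter_congr fun x _ => by omega
  rw [f1, f2, card_windmills_neg hD] at e2
  rw [card_windmills_pos hD] at e1
  rw [← card_windmills_zero, ← e1, ← e2, ← e3]
  push_cast
  ring

/-- The reflection exchanging the two sign changes of `t k^2 + b k - c` along `k ∈ ℤ`; here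
`R` is the integer square root of the discriminant. -/
def flipSign (R : ℤ) (x : ℤ × ℤ × ℤ) : ℤ × ℤ × ℤ :=
  let q := if R < x.1 then 0 else (R - x.2.1) / (2 * x.1)
  (x.1, - x.2.1 - 2 * x.1 * q, x.2.2 - x.2.1 * q - x.1 * q ^ 2)

/-- For `f(k) = t k² + b k - c`, the conditions say `f(-1) > 0 > f(0)`: the smaller root lies in
`(-1, 0)`. Since `(2t - b)² - D = 4t (t - b - c)`, this becomes a range for `b` in terms of `R =
⌊√D⌋`; the next lemma is the converse. -/
theorem signChanges_bounds {D R t b c : ℤ} (hR0 : 0 ≤ R) (hR : R ^ 2 ≤ D)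
    (hR' : D < (R + 1) ^ 2) (h : (t, b, c) ∈ signChanges D) : -R ≤ b ∧ b ≤ R ∧ b < 2 * t - R := by
  obtain ⟨ht, hc, -, -, h, hlt⟩ := mem_signChanges.mp h
  have htc := mul_pos ht hc
  have hb : |b| < |R + 1| := sq_lt_sq.mp (by linarith)
  rw [abs_of_nonneg (by omega : 0 ≤ R + 1), abs_lt] at hb
  have h2 : t * (b + c) < t * t := mul_lt_mul_of_pos_left hlt ht
  have h3 : |R| < |2 * t - b| := sq_lt_sq.mp (by nlinarith)
  rw [abs_of_nonneg hR0, abs_of_nonneg (by omega : 0 ≤ 2 * t - b)] at h3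
  omega

theorem mem_signChanges_of_bounds {D R t b c : ℤ} (hR0 : 0 ≤ R) (hR : R ^ 2 ≤ D)
    (hR' : D < (R + 1) ^ 2) (ht : 0 < t) (ht3 : t % 3 = 0) (hc3 : c % 3 ≠ 0)
    (h : b ^ 2 + 4 * t * c = D) (hb : -R ≤ b) (hbR : b ≤ R) (hbt : b < 2 * t - R) :
    (t, b, c) ∈ signChanges D := by
  have hb2 : b ^ 2 ≤ R ^ 2 := sq_le_sq.mpr (by rw [abs_of_nonneg hR0]; exact abs_le.mpr ⟨hb, hbR⟩)
  have hc0 : 0 ≤ c := nonneg_of_mul_nonneg_right (by linarith : 0 ≤ 4 * t * c) (by omega)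
  have h2 : (R + 1) ^ 2 ≤ (2 * t - b) ^ 2 := pow_le_pow_left₀ (by omega) (by omega) 2
  have h3 : b + c < t := by
    have : (4 * t) * (b + c) < (4 * t) * t := by nlinarith
    exact lt_of_mul_lt_mul_left this (by omega)
  exact mem_signChanges.mpr ⟨ht, by omega, ht3, hc3, h, h3⟩

/-- The reflected polynomial is `f(q - k)`, where `q` is the largest integer with `f(q) < 0`; for `R
< t` the roots are less than 1 apart and `q = 0`. Reflection moves the other sign change to `(-1,
0)`. Modulo 3, `f` is the nonzero constant `-c`. -/
theorem flipSign_mem {D R : ℤ} (hD : D % 3 = 0) (hR0 : 0 ≤ R) (hR : R ^ 2 ≤ D)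
    (hR' : D < (R + 1) ^ 2) {x : ℤ × ℤ × ℤ} (h : x ∈ signChanges D) :
    flipSign R x ∈ signChanges D := by
  obtain ⟨t, b, c⟩ := x
  obtain ⟨b1, b2, b3⟩ := signChanges_bounds hR0 hR hR' h
  obtain ⟨ht, hc, ht3, hc3, h, hlt⟩ := mem_signChanges.mp h
  have hb3 := emod_three_eq_zero_of_sq_add hD ht3 h
  simp only [flipSign]
  set q := if R < t then 0 else (R - b) / (2 * t) with hq
  refine mem_signChanges_of_bounds hR0 hR hR' ht ht3 ?_ (by linear_combination h) ?_ ?_ ?_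
  · obtain ⟨u, rfl⟩ := Int.dvd_of_emod_eq_zero ht3
    obtain ⟨v, rfl⟩ := Int.dvd_of_emod_eq_zero hb3
    rw [show c - 3 * v * q - 3 * u * q ^ 2 = c + 3 * (- v * q - u * q ^ 2) by ring,
      Int.add_mul_emod_self_left]
    exact hc3
  all_goals
    by_cases hlt : R < t
    · rw [if_pos hlt] at hq
      rw [hq]; omega
    · rw [if_neg hlt] at hq
      have m1 := Int.mul_ediv_add_emod (R - b) (2 * t)
      have m2 := Int.emod_nonneg (R - b) (by omega : 2 * t ≠ 0)
      have m3 := Int.emod_lt_of_pos (R - b) (by omega : 0 < 2 * t)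
      rw [← hq] at m1
      linarith

theorem flipSign_flipSign {D R : ℤ} (hR0 : 0 ≤ R) (hR : R ^ 2 ≤ D)
    (hR' : D < (R + 1) ^ 2) {x : ℤ × ℤ × ℤ} (h : x ∈ signChanges D) :
    flipSign R (flipSign R x) = x := by
  obtain ⟨t, b, c⟩ := x
  obtain ⟨b1, b2, b3⟩ := signChanges_bounds hR0 hR hR' h
  obtain ⟨ht, -⟩ := mem_signChanges.mp h
  simp only [flipSign]
  by_cases hlt : R < t
  · simp [hlt]
  · simp only [if_neg hlt]
    set q := (R - b) / (2 * t)
    have : (R - (- b - 2 * t * q)) / (2 * t) = q := by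
      rw [show R - (- b - 2 * t * q) = (R + b) + 2 * t * q by ring,
        Int.add_mul_ediv_left _ _ (by omega : 2 * t ≠ 0),
        Int.ediv_eq_zero_of_lt (by omega) (by omega), zero_add]
    rw [this]
    simp only [Prod.mk.injEq, true_and]
    constructor <;> ring

theorem dvd_flipSign {R t b c : ℤ} : t ∣ (flipSign R (t, b, c)).2.1 ↔ t ∣ b := by
  simp only [flipSign]
  rw [mul_comm 2 t, mul_assoc, dvd_sub_left (dvd_mul_right _ _), dvd_neg]

/-- A fixed point has `b = -t q`. The case `R < t` would force `b = 0` and `D` even. -/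
theorem dvd_of_flipSign_eq {D R t b c : ℤ} (hD : D % 2 = 1) (h : (t, b, c) ∈ signChanges D)
    (hf : flipSign R (t, b, c) = (t, b, c)) : t ≤ R ∧ t ∣ b := by
  obtain ⟨ht, hc, ht3, hc3, h, hlt⟩ := mem_signChanges.mp h
  simp only [flipSign, Prod.mk.injEq, true_and] at hf
  obtain ⟨hf, -⟩ := hf
  by_cases hlt : R < t
  · rw [if_pos hlt] at hf
    have : b = 0 := by omega
    subst this
    rw [← h] at hD
    exfalso
    have : (0 ^ 2 + 4 * t * c : ℤ) = 2 * (2 * t * c) := by ring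
    omega
  · rw [if_neg hlt] at hf
    exact ⟨by omega, ⟨- ((R - b) / (2 * t)), by linarith⟩⟩

theorem card_signChanges_eq_card_dvd {D R : ℤ} (hD : D % 3 = 0) (hD2 : D % 2 = 1) (hR0 : 0 ≤ R)
    (hR : R ^ 2 ≤ D) (hR' : D < (R + 1) ^ 2) :
    ((signChanges D).card : ZMod 2) =
      ((signChanges D).filter fun x => x.1 ≤ R ∧ x.1 ∣ x.2.1).card := by
  rw [← Finset.card_filter_add_card_filter_not (s := signChanges D)
    (fun x => x.1 ≤ R ∧ x.1 ∣ x.2.1), Nat.cast_add, add_eq_left, Finset.cast_card]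
  refine Finset.sum_involution (fun x _ => flipSign R x) (fun x _ => by decide) ?_ ?_ ?_
  · rintro ⟨t, b, c⟩ hx _ hf
    obtain ⟨hx, hn⟩ := Finset.mem_filter.mp hx
    exact hn (dvd_of_flipSign_eq hD2 hx hf)
  · rintro ⟨t, b, c⟩ hx
    obtain ⟨hx, hn⟩ := Finset.mem_filter.mp hx
    refine Finset.mem_filter.mpr ⟨flipSign_mem hD hR0 hR hR' hx, fun hn' => hn ⟨hn'.1, ?_⟩⟩
    exact dvd_flipSign.mp hn'.2
  · intro x hx
    exact flipSign_flipSign hR0 hR hR' (Finset.mem_filter.mp hx).1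

/-- With `b = t k`, `D = t (t k² + 4c)` makes `t` a divisor, and oddness of `D` makes `k` odd.
Conversely, for `t ≤ R` the admissible `b` fill `[-R, 2t - R)`, of length `2t`, which contains
exactly one odd multiple of `t`. -/
theorem card_signChanges_dvd (N : ℕ) :
    ((signChanges (12 * N + 9)).filter
      fun x => x.1 ≤ (Nat.sqrt (12 * N + 9) : ℤ) ∧ x.1 ∣ x.2.1).card =
      ((12 * N + 9).divisors.filter
        fun t => 3 ∣ t ∧ t * t ≤ 12 * N + 9 ∧ ¬ 3 ∣ (12 * N + 9) / t).card := by
  have hR0 : (0 : ℤ) ≤ (Nat.sqrt (12 * N + 9) : ℤ) := Int.natCast_nonneg _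
  have hR : ((Nat.sqrt (12 * N + 9) : ℤ)) ^ 2 ≤ 12 * N + 9 := by
    exact_mod_cast Nat.sqrt_le' (12 * N + 9)
  have hR' : (12 * N + 9 : ℤ) < ((Nat.sqrt (12 * N + 9) : ℤ) + 1) ^ 2 := by
    exact_mod_cast Nat.lt_succ_sqrt' (12 * N + 9)
  have hle : ∀ t : ℕ, t * t ≤ 12 * N + 9 ↔ t ≤ Nat.sqrt (12 * N + 9) := fun t => Nat.le_sqrt.symm
  simp only [hle]
  set R := Nat.sqrt (12 * N + 9)
  have odd_of : ∀ t k c : ℤ, (t * k) ^ 2 + 4 * t * c = 12 * N + 9 → t % 2 = 1 ∧ k % 2 = 1 := by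
    intro t k c h
    constructor
    · by_contra hc
      obtain ⟨u, rfl⟩ : ∃ u, t = 2 * u := ⟨t / 2, by omega⟩
      have : 2 * (u * k * (2 * u * k)  + 4 * u * c) = 12 * N + 9 := by rw [← h]; ring
      omega
    · by_contra hc
      obtain ⟨u, rfl⟩ : ∃ u, k = 2 * u := ⟨k / 2, by omega⟩
      have : 2 * (2 * (t * u) ^ 2  + 2 * t * c) = 12 * N + 9 := by rw [← h]; ring
      omega
  refine Finset.card_bij (fun x _ => x.1.toNat) ?_ ?_ ?_
  · rintro ⟨t, b, c⟩ hx
    obtain ⟨hx, htR, k, hk⟩ := Finset.mem_filter.mp hx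
    simp only at htR hk
    subst hk
    obtain ⟨ht, hc, ht3, hc3, h, hlt⟩ := mem_signChanges.mp hx
    lift t to ℕ using ht.le
    have hco : (12 * N + 9 : ℤ) = t * (t * k ^ 2 + 4 * c) := by rw [← h]; ring
    have hpos : 0 ≤ t * k ^ 2 + 4 * c := by positivity
    obtain ⟨e, he⟩ := Int.eq_ofNat_of_zero_le hpos
    have hco' : 12 * N + 9 = t * e := by rw [he] at hco; exact_mod_cast hco
    have ht0 : 0 < t := by exact_mod_cast ht
    rw [Int.toNat_natCast, Finset.mem_filter, Nat.mem_divisors]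
    refine ⟨⟨⟨_, hco'⟩, by omega⟩, by omega, by exact_mod_cast htR, ?_⟩
    rw [hco', Nat.mul_div_cancel_left _ ht0]
    obtain ⟨u, hu⟩ := Int.dvd_of_emod_eq_zero ht3
    rw [hu, mul_assoc] at he
    intro h3
    omega
  · rintro ⟨t, b, c⟩ hx ⟨t', b', c'⟩ hx' htt
    obtain ⟨hx, htR, k, hk⟩ := Finset.mem_filter.mp hx
    obtain ⟨hx', htR', k', hk'⟩ := Finset.mem_filter.mp hx'
    simp only at htR hk htR' hk' htt
    obtain ⟨ht, hc, ht3, hc3, h, hlt⟩ := mem_signChanges.mp hx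
    obtain ⟨ht', hc', ht3', hc3', h', hlt'⟩ := mem_signChanges.mp hx'
    have : t' = t := by omega
    subst this
    obtain ⟨b1, b2, b3⟩ := signChanges_bounds hR0 hR hR' hx
    obtain ⟨b1', b2', b3'⟩ := signChanges_bounds hR0 hR hR' hx'
    subst hk hk'
    have o1 := (odd_of _ _ _ h).2
    have o2 := (odd_of _ _ _ h').2
    have k1 : k - k' < 2 := lt_of_mul_lt_mul_left (by linarith : t' * (k - k') < t' * 2) ht.le
    have k2 : k' - k < 2 := lt_of_mul_lt_mul_left (by linarith : t' * (k' - k) < t' * 2) ht.le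
    have : k = k' := by omega
    subst this
    have : 4 * t' * c = 4 * t' * c' := by linarith
    have := mul_left_cancel₀ (by omega : 4 * t' ≠ 0) this
    rw [this]
  · intro t ht
    obtain ⟨hd, h3, htR, hn3⟩ := Finset.mem_filter.mp ht
    have ht0 : 0 < t := Nat.pos_of_mem_divisors hd
    obtain ⟨e, he⟩ := Nat.dvd_of_mem_divisors hd
    rw [he, Nat.mul_div_cancel_left _ ht0] at hn3
    have hmod : t % 2 = 1 ∧ t % 4 = e % 4 := by
      have h4 : (t % 4) * (e % 4) % 4 = 1 := by rw [← Nat.mul_mod, ← he]; omega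
      have l1 : t % 4 < 4 := Nat.mod_lt _ (by norm_num)
      have l2 : e % 4 < 4 := Nat.mod_lt _ (by norm_num)
      have : t % 4 = 0 ∨ t % 4 = 1 ∨ t % 4 = 2 ∨ t % 4 = 3 := by omega
      rcases this with h | h | h | h <;> rw [h] at h4 <;> omega
    obtain ⟨j, hj⟩ : ∃ j : ℤ, (e : ℤ) = t + 4 * j := ⟨((e : ℤ) - t) / 4, by omega⟩
    have heZ : (12 * N + 9 : ℤ) = t * e := by exact_mod_cast he
    -- This `q` places the odd multiple `b = t (1 - 2q)` in the window `[-R, 2t - R)`; `c` is then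
    -- forced by `t k² + 4c = e = t + 4j`.
    set q := ((t : ℤ) + R) / (2 * t) with hq
    have m1 := Int.mul_ediv_add_emod ((t : ℤ) + R) (2 * t)
    have m2 := Int.emod_nonneg ((t : ℤ) + R) (by omega : 2 * (t : ℤ) ≠ 0)
    have m3 := Int.emod_lt_of_pos ((t : ℤ) + R) (by omega : 0 < 2 * (t : ℤ))
    rw [← hq] at m1
    have htR' : (t : ℤ) ≤ R := by exact_mod_cast htR
    refine ⟨(t, t * (1 - 2 * q), j - t * (q ^ 2 - q)), ?_, Int.toNat_natCast t⟩
    refine Finset.mem_filter.mpr ⟨mem_signChanges_of_bounds hR0 hR hR' (by omega) (by omega) ?_ ?_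
      ?_ ?_ ?_, htR', dvd_mul_right _ _⟩
    · obtain ⟨u, rfl⟩ := h3
      push_cast at hj ⊢
      rw [mul_assoc]
      omega
    · rw [heZ, hj]; ring
    · linarith
    · linarith
    · linarith

/-- When `s² = 12i + 1`, the equation becomes `d e = 3n + 2`; the condition `s ≡ 1 (mod 3)` selects
one of the two signs of `s`. -/
theorem card_windmills_fiber {N i n : ℕ} (hin : i + n = N) :
    (((windmills (12 * N + 9)).filter fun x => x.1 ^ 2 = 12 * (i : ℤ) + 1).card : ZMod 2) =
      (if IsSquare (12 * i + 1) then 1 else 0) *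
        (((3 * n + 2).divisors.filter fun d => d % 3 = 1).card : ZMod 2) := by
  have hN : (N : ℤ) = i + n := by exact_mod_cast hin.symm
  split_ifs with h
  · obtain ⟨r, hr⟩ := h
    have hrZ : (12 * i + 1 : ℤ) = r ^ 2 := by rw [sq]; exact_mod_cast hr
    have hr3 : r % 3 = 1 ∨ r % 3 = 2 := by
      have : r % 3 < 3 := Nat.mod_lt _ (by norm_num)
      have h6 : (r % 3) * (r % 3) % 3 = 1 := by rw [← Nat.mul_mod, ← hr]; omega
      interval_cases r % 3 <;> omega
    obtain ⟨s, hs3, hs⟩ : ∃ s : ℤ, s % 3 = 1 ∧ (s = r ∨ s = -r) := by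
      rcases hr3 with h | h
      · exact ⟨r, by omega, Or.inl rfl⟩
      · exact ⟨-r, by omega, Or.inr rfl⟩
    have hs2 : s ^ 2 = 12 * i + 1 := by rw [hrZ]; exact sq_eq_sq_iff_eq_or_eq_neg.mpr hs
    rw [one_mul]
    congr 1
    symm
    refine Finset.card_bij (fun d _ => (s, (d : ℤ), (((3 * n + 2) / d : ℕ) : ℤ))) ?_ ?_ ?_
    · intro d hd
      obtain ⟨hd, hd3⟩ := Finset.mem_filter.mp hd
      have hd0 : 0 < d := Nat.pos_of_mem_divisors hd
      obtain ⟨e, he⟩ := Nat.dvd_of_mem_divisors hd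
      rw [he, Nat.mul_div_cancel_left _ hd0, Finset.mem_filter, mem_windmills]
      have heZ : (3 * n + 2 : ℤ) = d * e := by exact_mod_cast he
      have he0 : 0 < e := Nat.pos_of_ne_zero (by rintro rfl; omega)
      have he3 : e % 3 = 2 := by
        have : (d % 3) * (e % 3) % 3 = 2 := by rw [← Nat.mul_mod, ← he]; omega
        rw [hd3] at this; omega
      exact ⟨⟨by omega, by omega, hs3, by omega, by omega,
        by linear_combination hs2 - 4 * heZ - 12 * hN⟩, hs2⟩
    · intro d _ d' _ h
      simp only [Prod.mk.injEq] at h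
      omega
    · rintro ⟨s', d, e⟩ hx
      obtain ⟨hx, hs'⟩ := Finset.mem_filter.mp hx
      obtain ⟨hd, he, hs3', hd3, he3, hx⟩ := mem_windmills.mp hx
      simp only at hs'
      have : s' = s := by
        have := sq_eq_sq_iff_eq_or_eq_neg.mp (hs'.trans hs2.symm)
        omega
      subst this
      lift d to ℕ using hd.le
      lift e to ℕ using he.le
      have hde : 3 * n + 2 = d * e := by
        zify
        linarith
      have hd0 : 0 < d := by exact_mod_cast hd
      refine ⟨d, ?_, ?_⟩
      · rw [Finset.mem_filter, Nat.mem_divisors]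
        exact ⟨⟨⟨_, hde⟩, by omega⟩, by omega⟩
      · rw [hde, Nat.mul_div_cancel_left _ hd0]
  · rw [zero_mul, Finset.card_eq_zero.mpr, Nat.cast_zero]
    rw [Finset.filter_eq_empty_iff]
    rintro ⟨s, d, e⟩ - hs
    simp only at hs
    refine h ⟨s.natAbs, ?_⟩
    zify
    rw [← hs, ← sq, sq_abs]

theorem sq_eq_of_mem_windmills {N : ℕ} {s d e : ℤ} (h : (s, d, e) ∈ windmills (12 * N + 9)) :
    ∃ j : ℕ, j ≤ N ∧ s ^ 2 = 12 * (j : ℤ) + 1 := by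
  obtain ⟨hd, he, hs3, -, -, h⟩ := mem_windmills.mp h
  have hodd : s % 2 = 1 := by
    by_contra hc
    obtain ⟨u, rfl⟩ : ∃ u, s = 2 * u := ⟨s / 2, by omega⟩
    have : 2 * (2 * u ^ 2 + 2 * d * e) = 12 * N + 9 := by rw [← h]; ring
    omega
  obtain ⟨k, rfl⟩ : ∃ k, s = 6 * k + 1 := ⟨s / 6, by omega⟩
  have hk : 0 ≤ k * (3 * k + 1) := by
    rcases le_or_gt 0 k with h | h
    · exact mul_nonneg h (by omega)
    · exact mul_nonneg_of_nonpos_of_nonpos h.le (by omega)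
  obtain ⟨j, hj⟩ := Int.eq_ofNat_of_zero_le hk
  have hs : (6 * k + 1) ^ 2 = 12 * (j : ℤ) + 1 := by rw [← hj]; ring
  refine ⟨j, ?_, hs⟩
  have := mul_pos hd he
  have : 12 * (j : ℤ) + 1 + 4 * (d * e) = 12 * N + 9 := by rw [← hs, ← h]; ring
  omega

theorem card_windmills_eq_sum (N : ℕ) :
    ((windmills (12 * N + 9)).card : ZMod 2) = coeff N (pentagonalIndicator * halfDivisorSeries) := by
  rw [coeff_mul, Finset.card_eq_sum_card_fiberwise
    (f := fun x => (((x.1 ^ 2 - 1) / 12).toNat, N - ((x.1 ^ 2 - 1) / 12).toNat))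
    (t := Finset.HasAntidiagonal.antidiagonal N), Nat.cast_sum]
  · refine Finset.sum_congr rfl fun p hp => ?_
    obtain ⟨i, n⟩ := p
    have hin := Finset.HasAntidiagonal.mem_antidiagonal.mp hp
    simp only at hin
    rw [pentagonalIndicator, halfDivisorSeries, coeff_mk, coeff_mk, ← card_windmills_fiber hin]
    congr 2
    refine Finset.filter_congr ?_
    rintro ⟨s, d, e⟩ hx
    obtain ⟨j, hj, hs⟩ := sq_eq_of_mem_windmills hx
    simp only [hs, Prod.mk.injEq]
    omega
  · rintro ⟨s, d, e⟩ hx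
    obtain ⟨j, hj, hs⟩ := sq_eq_of_mem_windmills hx
    simp only [hs, Finset.mem_coe, Finset.HasAntidiagonal.mem_antidiagonal]
    omega

/-- The parity form of the divisor-sum recurrence behind `ρ^{(3)}`. -/
theorem pentagonalIndicator_mul_halfDivisorSeries :
    pentagonalIndicator * halfDivisorSeries = smallDivisorSeries := by
  ext N
  rw [← card_windmills_eq_sum, card_windmills_eq, card_signChanges_eq_card_dvd
    (R := Nat.sqrt (12 * N + 9)) (by omega) (by omega) (Int.natCast_nonneg _)
    (by exact_mod_cast Nat.sqrt_le' (12 * N + 9))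
    (by exact_mod_cast Nat.lt_succ_sqrt' (12 * N + 9)), card_signChanges_dvd, smallDivisorSeries,
    coeff_mk]

theorem map_rhoThree :
    PowerSeries.map (Int.castRingHom (ZMod 2)) rhoThree = halfDivisorSeries := by
  refine mul_left_cancel₀ (fun h => ?_)
    (pentagonalIndicator_mul_rhoThree.trans pentagonalIndicator_mul_halfDivisorSeries.symm)
  have := congrArg (coeff 0) h
  simp [pentagonalIndicator] at this

end Windmill

/-! ### Numbers `p k²` and density zero -/

section Density

theorem card_divisors_eq_mul_of_prime {p M : ℕ} (hp : p.Prime) (hM : M ≠ 0) :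
    M.divisors.card = (M.factorization p + 1) * (M / p ^ M.factorization p).divisors.card := by
  conv_lhs => rw [← Nat.ordProj_mul_ordCompl_eq_self M p]
  rw [Nat.Coprime.card_divisors_mul ((Nat.coprime_ordCompl hp hM).pow_left _),
    Nat.divisors_prime_pow hp, Finset.card_map, Finset.card_range]

theorem two_mul_card_divisors_mod_three (n : ℕ) :
    2 * ((3 * n + 2).divisors.filter fun d => d % 3 = 1).card = (3 * n + 2).divisors.card := by
  rw [← Finset.card_filter_add_card_filter_not (s := (3 * n + 2).divisors) (fun d => d % 3 = 1),
    two_mul, add_right_inj]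
  have key : ∀ d ∈ (3 * n + 2).divisors, (3 * n + 2) / d ∈ (3 * n + 2).divisors ∧
      (d % 3 = 1 ↔ ¬ (3 * n + 2) / d % 3 = 1) ∧ (3 * n + 2) / ((3 * n + 2) / d) = d := by
    intro d hd
    have hd0 : 0 < d := Nat.pos_of_mem_divisors hd
    obtain ⟨e, he⟩ := Nat.dvd_of_mem_divisors hd
    have he0 : 0 < e := Nat.pos_of_ne_zero (by rintro rfl; omega)
    rw [he, Nat.mul_div_cancel_left _ hd0, Nat.mul_div_cancel _ he0, Nat.mem_divisors]
    refine ⟨⟨dvd_mul_left _ _, by positivity⟩, ?_, rfl⟩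
    have h3 : (d % 3) * (e % 3) % 3 = 2 := by rw [← Nat.mul_mod, ← he]; omega
    have : d % 3 = 0 ∨ d % 3 = 1 ∨ d % 3 = 2 := by omega
    rcases this with h | h | h <;> rw [h] at h3 <;> omega
  refine Finset.card_nbij' (fun d => (3 * n + 2) / d) (fun d => (3 * n + 2) / d) ?_ ?_ ?_ ?_
  · intro d hd
    obtain ⟨hd, h⟩ := Finset.mem_filter.mp hd
    exact Finset.mem_filter.mpr ⟨(key d hd).1, (key d hd).2.1.mp h⟩
  · intro d hd
    obtain ⟨hd, h⟩ := Finset.mem_filter.mp hd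
    refine Finset.mem_filter.mpr ⟨(key d hd).1, ?_⟩
    have := (key d hd).2.1
    tauto
  · intro d hd
    exact (key d (Finset.mem_filter.mp hd).1).2.2
  · intro d hd
    exact (key d (Finset.mem_filter.mp hd).1).2.2

theorem odd_factorization_of_dvd_squarefree {a b p : ℕ} (ha : Squarefree a) (hp : p.Prime)
    (hpa : p ∣ a) (hb : b ≠ 0) : Odd ((b ^ 2 * a).factorization p) := by
  have h1 : a.factorization p = 1 :=
    le_antisymm (ha.natFactorization_le_one p) ((hp.dvd_iff_one_le_factorization ha.ne_zero).mp hpa)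
  rw [Nat.factorization_mul (pow_ne_zero 2 hb) ha.ne_zero, Nat.factorization_pow]
  simp [h1]

/-- Write `M = b² a` with `a` squarefree. Two distinct primes dividing `a` have odd exponents in
`M`, and each contributes an even factor to the divisor count; so `a` is prime. -/
theorem exists_prime_mul_sq_of_card_divisors {M : ℕ} (hM : ¬ IsSquare M)
    (h : ¬ 4 ∣ M.divisors.card) : ∃ p k, p.Prime ∧ M = p * k ^ 2 := by
  have hM0 : M ≠ 0 := by rintro rfl; exact hM ⟨0, rfl⟩
  obtain ⟨a, b, hab, ha⟩ := Nat.sq_mul_squarefree M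
  have hb : b ≠ 0 := by rintro rfl; simp at hab; omega
  have ha1 : a ≠ 1 := by
    rintro rfl
    exact hM ⟨b, by rw [← hab]; ring⟩
  obtain ⟨p, hp, c, rfl⟩ := Nat.exists_prime_and_dvd ha1
  by_cases hc : c = 1
  · exact ⟨p, b, hp, by rw [← hab, hc]; ring⟩
  obtain ⟨q, hq, hqc⟩ := Nat.exists_prime_and_dvd hc
  have hpq : p ≠ q := by
    rintro rfl
    exact hp.one_lt.ne' (Nat.isUnit_iff.mp (ha p (mul_dvd_mul_left p hqc)))
  have op := odd_factorization_of_dvd_squarefree ha hp (dvd_mul_right p c) hb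
  have oq := odd_factorization_of_dvd_squarefree ha hq (dvd_mul_of_dvd_right hqc p) hb
  rw [hab] at op oq
  set m := M / p ^ M.factorization p with hm
  have hm0 : m ≠ 0 := (Nat.ordCompl_pos p hM0).ne'
  have hmq : m.factorization q = M.factorization q := by
    rw [hm, Nat.factorization_ordCompl, Finsupp.erase_ne hpq.symm]
  exfalso
  apply h
  rw [card_divisors_eq_mul_of_prime hp hM0, ← hm, card_divisors_eq_mul_of_prime hq hm0, hmq,
    ← mul_assoc]
  exact dvd_mul_of_dvd_left (mul_dvd_mul (a := 2) (c := 2) op.add_one.two_dvd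
    oq.add_one.two_dvd) _

theorem exists_prime_mul_sq_of_odd_coeff {n : ℕ} (h : ¬ Even (coeff n rhoThree)) :
    ∃ p k, p.Prime ∧ 3 * n + 2 = p * k ^ 2 := by
  have hc : ((coeff n rhoThree : ℤ) : ZMod 2) =
      (((3 * n + 2).divisors.filter fun d => d % 3 = 1).card : ZMod 2) := by
    have := congrArg (coeff n) map_rhoThree
    rwa [PowerSeries.coeff_map, halfDivisorSeries, coeff_mk] at this
  refine exists_prime_mul_sq_of_card_divisors ?_ ?_
  · rintro ⟨r, hr⟩
    have h3 : (r % 3) * (r % 3) % 3 = 2 := by rw [← Nat.mul_mod, ← hr]; omega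
    have : r % 3 < 3 := Nat.mod_lt _ (by norm_num)
    interval_cases r % 3 <;> omega
  · intro h4
    rw [← two_mul_card_divisors_mod_three] at h4
    apply h
    rw [even_iff_two_dvd]
    have : (2 : ℤ) = ((2 : ℕ) : ℤ) := rfl
    rw [this, ← ZMod.intCast_zmod_eq_zero_iff_dvd, hc, ZMod.natCast_eq_zero_iff]
    omega

theorem exists_primeCounting_le {ε : ℝ} (hε : 0 < ε) :
    ∃ C : ℝ, 0 ≤ C ∧ ∀ y : ℕ, (Nat.primeCounting y : ℝ) ≤ ε * y + C := by
  have h1 : ∀ᶠ x : ℝ in atTop, (Real.log 4 + 1) / ε ≤ Real.log x :=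
    Real.tendsto_log_atTop.eventually_ge_atTop _
  -- Beyond `x₀` Chebyshev's bound `(log 4 + 1) y / log y` is at most `ε y`; below it, `π(y)` is
  -- absorbed into the constant.
  obtain ⟨x₀, hx₀⟩ := eventually_atTop.mp
    ((Chebyshev.eventually_primeCounting_le one_pos).and (h1.and (eventually_gt_atTop 1)))
  refine ⟨Nat.primeCounting ⌈x₀⌉₊, Nat.cast_nonneg _, fun y => ?_⟩
  rcases le_total x₀ y with h | h
  · obtain ⟨h2, h3, h4⟩ := hx₀ y h
    rw [Nat.floor_natCast] at h2
    have hlog : 0 < Real.log y := Real.log_pos h4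
    have h5 : (Real.log 4 + 1) * y / Real.log y ≤ ε * y := by
      rw [div_le_iff₀ hε] at h3
      rw [div_le_iff₀ hlog]
      nlinarith
    have : (0 : ℝ) ≤ Nat.primeCounting ⌈x₀⌉₊ := Nat.cast_nonneg _
    linarith
  · have h2 : Nat.primeCounting y ≤ Nat.primeCounting ⌈x₀⌉₊ :=
      Nat.monotone_primeCounting (by exact_mod_cast h.trans (Nat.le_ceil x₀))
    have h3 : (Nat.primeCounting y : ℝ) ≤ Nat.primeCounting ⌈x₀⌉₊ := by exact_mod_cast h2
    have : 0 ≤ ε * y := by positivity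
    linarith

theorem card_odd_coeff_le_sum (N : ℕ) :
    ((Finset.range N).filter fun n => ¬ Even (coeff n rhoThree)).card ≤
      ∑ k ∈ Finset.Ioo 0 (Nat.sqrt (3 * N) + 1), Nat.primeCounting (3 * N / k ^ 2) := by
  -- Each odd coefficient has `3n + 2 = p k² ≤ 3N`, and `n` is recovered from `(p, k)`.
  have hsub : ((Finset.range N).filter fun n => ¬ Even (coeff n rhoThree)) ⊆
      (Finset.Ioo 0 (Nat.sqrt (3 * N) + 1)).biUnion fun k =>
        (Nat.primesLE (3 * N / k ^ 2)).image fun p => (p * k ^ 2 - 2) / 3 := by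
    intro n hn
    obtain ⟨hn, hodd⟩ := Finset.mem_filter.mp hn
    have hn := Finset.mem_range.mp hn
    obtain ⟨p, k, hp, h⟩ := exists_prime_mul_sq_of_odd_coeff hodd
    have hk : 0 < k := Nat.pos_of_ne_zero (by rintro rfl; simp at h)
    have hle : p * k ^ 2 ≤ 3 * N := by omega
    rw [Finset.mem_biUnion]
    refine ⟨k, Finset.mem_Ioo.mpr ⟨hk, Nat.lt_succ_of_le (Nat.le_sqrt'.mpr ?_)⟩,
      Finset.mem_image.mpr ⟨p, ?_, by omega⟩⟩
    · exact (Nat.le_mul_of_pos_left _ hp.pos).trans hle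
    · rw [Nat.mem_primesLE]
      exact ⟨(Nat.le_div_iff_mul_le (by positivity)).mpr hle, hp⟩
  refine (Finset.card_le_card hsub).trans (Finset.card_biUnion_le.trans
    (Finset.sum_le_sum fun k _ => ?_))
  rw [← Nat.primesLE_card_eq_primeCounting]
  exact Finset.card_image_le

theorem card_odd_coeff_le {ε C : ℝ} (hε : 0 < ε)
    (hC : ∀ y : ℕ, (Nat.primeCounting y : ℝ) ≤ ε * y + C) (N : ℕ) :
    (((Finset.range N).filter fun n => ¬ Even (coeff n rhoThree)).card : ℝ) ≤
      6 * ε * N + C * Nat.sqrt (3 * N) := by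
  have h1 : (((Finset.range N).filter fun n => ¬ Even (coeff n rhoThree)).card : ℝ) ≤
      ∑ k ∈ Finset.Ioo 0 (Nat.sqrt (3 * N) + 1), (Nat.primeCounting (3 * N / k ^ 2) : ℝ) := by
    exact_mod_cast card_odd_coeff_le_sum N
  have h2 : ∑ k ∈ Finset.Ioo 0 (Nat.sqrt (3 * N) + 1), (Nat.primeCounting (3 * N / k ^ 2) : ℝ) ≤
      ∑ k ∈ Finset.Ioo 0 (Nat.sqrt (3 * N) + 1), (3 * ε * N * ((k : ℝ) ^ 2)⁻¹ + C) := by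
    refine Finset.sum_le_sum fun k _ => (hC _).trans ?_
    have : ((3 * N / k ^ 2 : ℕ) : ℝ) ≤ 3 * N * ((k : ℝ) ^ 2)⁻¹ := by
      refine Nat.cast_div_le.trans (le_of_eq ?_)
      push_cast; rw [div_eq_mul_inv]
    nlinarith
  have h3 := sum_Ioo_inv_sq_le (α := ℝ) 0 (Nat.sqrt (3 * N) + 1)
  rw [Finset.sum_add_distrib, ← Finset.mul_sum, Finset.sum_const, Nat.card_Ioo, nsmul_eq_mul,
    show Nat.sqrt (3 * N) + 1 - 0 - 1 = Nat.sqrt (3 * N) by omega] at h2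
  have h4 : 3 * ε * N * ∑ k ∈ Finset.Ioo 0 (Nat.sqrt (3 * N) + 1), ((k : ℝ) ^ 2)⁻¹ ≤
      3 * ε * N * 2 := by
    refine mul_le_mul_of_nonneg_left (h3.trans (by norm_num)) (by positivity)
  linarith

theorem tendsto_card_odd_coeff_div :
    Tendsto (fun N : ℕ =>
      (((Finset.range N).filter fun n => ¬ Even (coeff n rhoThree)).card : ℝ) / (N : ℝ))
      atTop (𝓝 0) := by
  rw [Metric.tendsto_atTop']
  intro ε hε
  -- With `ε / 24` the linear term is `ε N / 4`; `√N > 8C / ε` bounds `C √(3N) ≤ 2C √N` by another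
  -- `ε N / 4`.
  obtain ⟨C, hC0, hC⟩ := exists_primeCounting_le (show 0 < ε / 24 by positivity)
  obtain ⟨N₀, hN₀⟩ := exists_nat_gt ((8 * C / ε) ^ 2)
  refine ⟨N₀, fun N hN => ?_⟩
  have hNN : (8 * C / ε) ^ 2 < N := hN₀.trans (by exact_mod_cast hN)
  have hN0 : (0 : ℝ) < N := (sq_nonneg _).trans_lt hNN
  have h1 := card_odd_coeff_le (show 0 < ε / 24 by positivity) hC N
  have hr : 8 * C / ε < √(N : ℝ) := Real.lt_sqrt_of_sq_lt hNN
  have hs : (Nat.sqrt (3 * N) : ℝ) ≤ 2 * √(N : ℝ) := by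
    refine Real.nat_sqrt_le_real_sqrt.trans ?_
    rw [Real.sqrt_le_left (by positivity), mul_pow, Real.sq_sqrt hN0.le]
    push_cast; linarith
  rw [div_lt_iff₀ hε] at hr
  have hsq := Real.mul_self_sqrt hN0.le
  have hpos : 0 < √(N : ℝ) := Real.sqrt_pos.mpr hN0
  have h2 : C * Nat.sqrt (3 * N) ≤ ε / 4 * N := by
    have a1 : C * Nat.sqrt (3 * N) ≤ C * (2 * √(N : ℝ)) := mul_le_mul_of_nonneg_left hs hC0
    have a2 : 8 * C * √(N : ℝ) ≤ √(N : ℝ) * ε * √(N : ℝ) :=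
      mul_le_mul_of_nonneg_right hr.le hpos.le
    have a3 : √(N : ℝ) * ε * √(N : ℝ) = ε * N := by
      linear_combination ε * hsq
    linarith
  rw [Real.dist_0_eq_abs, abs_of_nonneg (by positivity), div_lt_iff₀ hN0]
  have : 0 < ε * N := by positivity
  linarith

end Density

theorem mainTheorem4 :
    Tendsto
      (fun N : ℕ => (((Finset.range N).filter (fun n => Even (coeff n rhoThree))).card : ℝ) / (N : ℝ))
      atTop (𝓝 1) := by
  have h := tendsto_card_odd_coeff_div.const_sub 1
  rw [sub_zero] at h
  refine h.congr' ?_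
  filter_upwards [eventually_gt_atTop 0] with N hN
  have hN0 : (N : ℝ) ≠ 0 := by exact_mod_cast hN.ne'
  have hcard := Finset.card_filter_add_card_filter_not (s := Finset.range N)
    (fun n => Even (coeff n rhoThree))
  rw [Finset.card_range] at hcard
  have hcard' : (((Finset.range N).filter fun n => Even (coeff n rhoThree)).card : ℝ) +
      ((Finset.range N).filter fun n => ¬ Even (coeff n rhoThree)).card = N := by
    exact_mod_cast hcard
  rw [eq_div_iff hN0, sub_mul, one_mul, div_mul_cancel₀ _ hN0]
  linarith
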